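/- Let $k\ge 1$ be an integer and $M>0$. There is a constant $C>0$ depending only on $M$ and $k$ such that the following holds. Let $w=(w_1,\dots,w_k)$ be functions on $[0,1]$ with $w_j\in C^{k-j+1}[0,1]$ and $1/M\le w_j\le M$ for $j=1,\dots,k$. Let $\mathcal F$ be a $\sigma$-algebra on $[0,1]$ generated by a finite partition of $[0,1]$ into intervals of positive length, and let $t_0\le t_1\le\dots\le t_n$ be the increasing enumeration of the boundary points of the atoms of $\mathcal F$, where $0$ and $1$ each appear $k$ times and every other boundary point appears once. Put $u_1^*=1$, $$u_j^*(y)=\int_0^y w_k(s_k)\int_0^{s_k}w_{k-1}(s_{k-1})\cdots\int_0^{s_{k-j+3}}w_{k-j+2}(s_{k-j+2})\,ds_{k-j+2}\cdots ds_k\quad(2\le j\le k+1),$$ $$g_k^w(x,y)=\mathbf 1_{x\ge y}\; w_1(x)\int_y^x w_2(s_2)\int_y^{s_2}\cdots\int_y^{s_{k-1}}w_k(s_k)\,ds_k\cdots ds_2$$ ($g_1^w(x,y)=\mathbf 1_{x\ge y}w_1(x)$ if $k=1$), and let the derivatives adapted to the system be $L_0f=f$, $L_{d+1}f=(L_df)'/w_{k-d}$,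 with derivatives taken on $[0,1]$ (one-sided at $0$ and $1$). For $s_1\le\dots\le s_m$ let $d_r=\max\{j\ge 0: s_r=\dots=s_{r-j}\}$ and $$D\begin{pmatrix}s_1,\dots,s_m\\ f_1,\dots,f_m\end{pmatrix}=\det\big(L_{d_r}f_l(s_r)\big)_{r,l=1}^m .$$ The Chebyshevian B-splines are $$M_i^w(x)=(-1)^k\,\frac{D\begin{pmatrix}t_i,\dots,t_{i+k}\\ u_1^*,\dots,u_k^*,g_k^w(x,\cdot)\end{pmatrix}}{D\begin{pmatrix}t_i,\dots,t_{i+k}\\ u_1^*,\dots,u_{k+1}^*\end{pmatrix}},\qquad 0\le i\le n-k,\ x\in[0,1],$$ and $M_i$ denotes the polynomial B-spline, obtained for $w_1=\dots=w_k=1$. Let $|\operatorname{supp}M_i|$ be the Lebesgue measure of the support of $M_i$ and $\omega(f,\delta)=\sup\{|f(x)-f(y)|:x,y\in[0,1],\ |x-y|<\delta\}$. Then for all $0\le i\le n-k$ and $x\in[0,1]$ $$|M_i^w(x)-M_i(x)|\le\frac{C}{|\operatorname{supp}M_i|}\max_{1\le j\le k}\omega\big(w_j,|\operatorname{supp}M_i|\big),\qquad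 |M_i^w(x)|\le\frac{C}{|\operatorname{supp}M_i|}.$$ Moreover, if in addition $w_j\in C^{j-2}[0,1]$ for $2\le j\le k$ (which is automatic for $k\le 3$), then $M_i^w(x)$ is unchanged when the ordinary derivatives $f^{(d)}$ are used in place of $L_df$ in both determinants; so the two estimates hold for the B-splines defined with ordinary derivatives as well. -/

import Mathlib

open Set MeasureTheory

namespace ChebSpline

noncomputable section

/-- An interval `σ`-algebra on `[0,1]`: it is generated by a finite partition of `[0,1]` into
intervals of positive length. -/
def IsIntervalSigmaAlgebra (𝓕 : MeasurableSpace (Icc (0 : ℝ) 1)) : Prop :=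
  ∃ P : Set (Set (Icc (0 : ℝ) 1)), P.Finite ∧ Setoid.IsPartition P ∧
    (∀ A ∈ P, A.OrdConnected ∧ 0 < volume (Subtype.val '' A : Set ℝ)) ∧
    𝓕 = MeasurableSpace.generateFrom P

/-- The boundary points (in `ℝ`) of the atoms of `𝓕`. -/
def gridPoints (𝓕 : MeasurableSpace (Icc (0 : ℝ) 1)) : Set ℝ :=
  {s | ∃ p : Icc (0 : ℝ) 1, s ∈ frontier (Subtype.val '' (@measurableAtom _ 𝓕 p) : Set ℝ)}

open Classical in
/-- `t 0 ≤ t 1 ≤ ⋯ ≤ t n` is the increasing enumeration of the boundary points of the atoms of `𝓕`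
in which `0` and `1` each appear `k` times and every other boundary point appears once.
(Values `t i` with `i > n` are irrelevant.) -/
structure IsGridSequence (k : ℕ) (𝓕 : MeasurableSpace (Icc (0 : ℝ) 1)) (n : ℕ) (t : ℕ → ℝ) :
    Prop where
  monotone : ∀ i j, i ≤ j → j ≤ n → t i ≤ t j
  count : ∀ s : ℝ, ((Finset.range (n + 1)).filter fun i => t i = s).card =
    if s = 0 ∨ s = 1 then k else if s ∈ gridPoints 𝓕 then 1 else 0

/-- `nestedIntegral a [f₁, …, f_r] x`
`= ∫_a^x f₁(s₁) ∫_a^{s₁} f₂(s₂) ⋯ ∫_a^{s_{r-1}} f_r(s_r) ds_r ⋯ ds₁`, and `1` for `r = 0`. -/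
def nestedIntegral (a : ℝ) : List (ℝ → ℝ) → ℝ → ℝ
  | [], _ => 1
  | f :: l, x => ∫ s in a..x, f s * nestedIntegral a l s

/-- The dual function `u_i^*`, `1 ≤ i ≤ k + 1`: the nested integral from `0` of
`w_k, w_{k-1}, …, w_{k-i+2}`. The weights are `w 1, …, w k`. -/
def dualFun (w : ℕ → ℝ → ℝ) (k i : ℕ) : ℝ → ℝ :=
  nestedIntegral 0 ((List.range (i - 1)).map fun r => w (k - r))

/-- `h_j^w(x,y) = w_1(x) ∫_y^x w_2(s_2) ∫_y^{s_2} ⋯ ∫_y^{s_{j-1}} w_j(s_j) ds_j ⋯ ds_2`. -/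
def hFun (w : ℕ → ℝ → ℝ) (j : ℕ) (x y : ℝ) : ℝ :=
  w 1 x * nestedIntegral y ((List.range (j - 1)).map fun r => w (r + 2)) x

/-- `g_j^w(x,y) = 1_{x ≥ y} h_j^w(x,y)`. -/
def gFun (w : ℕ → ℝ → ℝ) (j : ℕ) (x y : ℝ) : ℝ :=
  if y ≤ x then hFun w j x y else 0

/-- The ordinary derivative of order `d` on `[0,1]` (one-sided at the end points). -/
def ordDeriv (d : ℕ) (f : ℝ → ℝ) : ℝ → ℝ :=
  iteratedDerivWithin d f (Icc 0 1)

/-- The derivatives adapted to the dual system: `L_0 f = f`, `L_{d+1} f = (L_d f)' / w_{k-d}`, with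
derivatives taken on `[0,1]` (one-sided at the end points). -/
def dualDeriv (w : ℕ → ℝ → ℝ) (k : ℕ) : ℕ → (ℝ → ℝ) → ℝ → ℝ
  | 0, f => f
  | d + 1, f => fun y => derivWithin (dualDeriv w k d f) (Icc 0 1) y / w (k - d) y

open Classical in
/-- `d_i`: the number of indices before `i` with the same node (for nondecreasing `s` this is the
largest `j` with `s_i = ⋯ = s_{i-j}`). -/
def repIndex {m : ℕ} (s : Fin m → ℝ) (i : Fin m) : ℕ :=
  (Finset.univ.filter fun j => j < i ∧ s j = s i).card

/-- `det (L_{d_i} u_j (s_i))_{i,j}`, where `L_d` is the derivative of order `d`. -/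
def confluentDet {m : ℕ} (L : ℕ → (ℝ → ℝ) → ℝ → ℝ) (s : Fin m → ℝ) (u : Fin m → ℝ → ℝ) : ℝ :=
  Matrix.det (Matrix.of fun i j : Fin m => L (repIndex s i) (u j) (s i))

/-- The quotient of determinants
`(-1)^k D(t_i,…,t_{i+k}; u_1^*,…,u_k^*, g_k^w(x,·)) / D(t_i,…,t_{i+k}; u_1^*,…,u_{k+1}^*)`,
where `D` is formed with the derivatives `L`. -/
def bsplineQuotient (L : ℕ → (ℝ → ℝ) → ℝ → ℝ) (w : ℕ → ℝ → ℝ) (k : ℕ) (t : ℕ → ℝ) (i : ℕ)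
    (x : ℝ) : ℝ :=
  (-1) ^ k *
    (confluentDet L (fun r : Fin (k + 1) => t (i + r))
        (fun j : Fin (k + 1) => if (j : ℕ) < k then dualFun w k (j + 1) else gFun w k x) /
      confluentDet L (fun r : Fin (k + 1) => t (i + r))
        (fun j : Fin (k + 1) => dualFun w k (j + 1)))

/-- The Chebyshevian B-spline `M_i^w`. The weights `w_k, w_{k-1}, …` need not be smooth enough for
the ordinary derivatives of `u_j^*` of order up to `k - 1` to exist, so the determinants are formed
with the adapted derivatives `L_d`. Where the ordinary derivatives exist, passing from one kind to
the other multiplies both matrices from the left by the same invertible triangular matrix, so that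
the quotient is the same. -/
def chebBSpline (w : ℕ → ℝ → ℝ) (k : ℕ) (t : ℕ → ℝ) (i : ℕ) (x : ℝ) : ℝ :=
  bsplineQuotient (dualDeriv w k) w k t i x

/-- The same quotient with ordinary derivatives. -/
def chebBSplineOrd (w : ℕ → ℝ → ℝ) (k : ℕ) (t : ℕ → ℝ) (i : ℕ) (x : ℝ) : ℝ :=
  bsplineQuotient ordDeriv w k t i x

/-- The polynomial B-spline `M_i`: all weights equal to `1`, ordinary derivatives. -/
def polyBSpline (k : ℕ) (t : ℕ → ℝ) (i : ℕ) (x : ℝ) : ℝ :=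
  chebBSplineOrd (fun _ _ => 1) k t i x

/-- `|supp M_i|`: the Lebesgue measure of the support of `M_i` in `[0,1]`. -/
def suppLength (k : ℕ) (t : ℕ → ℝ) (i : ℕ) : ℝ :=
  volume.real (closure {x ∈ Icc (0 : ℝ) 1 | polyBSpline k t i x ≠ 0})

/-- The modulus of continuity on `[0,1]`: `ω(f,δ) = sup_{|x-y|<δ} |f(x)-f(y)|`. -/
def modulus (f : ℝ → ℝ) (δ : ℝ) : ℝ :=
  sSup {r | ∃ x ∈ Icc (0 : ℝ) 1, ∃ y ∈ Icc (0 : ℝ) 1, |x - y| < δ ∧ r = |f x - f y|}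

end

end ChebSpline

/-! The spline `M_i^w(x)` is a quotient `V / U` of two collocation determinants at the same nodes:
the last column of `U` is `u_{k+1}^*`, that of `V` is `(-1)^k g_k^w(x, ·)`. Both systems are closed
under the adapted derivative: differentiating and dividing by the top weight lowers the order by
one.

Subtracting neighbouring rows clears the column of ones and turns the other entries into integrals
over the gaps between nodes. By multilinearity, a determinant is therefore the integral, over all
vectors interlacing with the nodes, of a product of values of the top weight times the determinant
of one order less (`blockMatrix_det_succ`). A repeated node `0` or `1` gives a degenerate gap, which
carries a Dirac mass instead of length. The recursion ends at two nodes, where `U` becomes an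
integral of `w_1` and `V` a jump of height `w_1(x)` at `x`. Thus `U` and `V` are built from products
of weights with the same positive measures as in the polynomial case.

On the support each `w_j` agrees with a constant `a_j` up to a factor `θ = 1 + MΩ`, where `Ω` is the
largest modulus of continuity. Replacing `w_j` by `a_j` costs a fixed power of `θ` in each
determinant (`blockMatrix_det_compare`), and the resulting product of constants is the same for `U`
and `V`, so it cancels. Hence `M_i^w` and `M_i` agree up to a factor `θ^N`, and `θ^N - 1 = O(Ω)`.

It remains to bound the polynomial spline by `C / |supp M_i|` (`blockMatrix_det_mul_length_le`).
This is an induction with the same integral formula, averaging over the reflection of one coordinate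
in the largest gap.

Ordinary derivatives are triangular combinations of adapted ones with coefficients independent of
the function, so the change of derivatives cancels in the quotient (`confluentDet_ordDeriv`). -/

namespace ChebSpline

/-! ### Nested integrals -/

lemma continuous_nestedIntegral (l : List (ℝ → ℝ)) (hl : ∀ f ∈ l, Continuous f) :
    Continuous fun p : ℝ × ℝ => nestedIntegral p.1 l p.2 := by
  induction l with
  | nil => exact continuous_const
  | cons f l ih =>
    have hf : Continuous f := hl f (by simp)
    have hc := ih fun g hg => hl g (by simp [hg])
    have hF : Continuous (Function.uncurry fun (p : ℝ × ℝ) (s : ℝ) =>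
        f s * nestedIntegral p.1 l s) :=
      (hf.comp continuous_snd).mul
        (hc.comp ((continuous_fst.comp continuous_fst).prodMk continuous_snd))
    have hi : ∀ (p : ℝ × ℝ) (a b : ℝ),
        IntervalIntegrable (fun s => f s * nestedIntegral p.1 l s) volume a b := fun p a b =>
      (hF.comp (Continuous.prodMk_right p)).intervalIntegrable a b
    have he : (fun p : ℝ × ℝ => nestedIntegral p.1 (f :: l) p.2) = fun p =>
        (∫ s in (0 : ℝ)..p.2, f s * nestedIntegral p.1 l s) -
          ∫ s in (0 : ℝ)..p.1, f s * nestedIntegral p.1 l s := by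
      ext p
      rw [intervalIntegral.integral_interval_sub_left (hi p _ _) (hi p _ _)]
      rfl
    rw [he]
    exact (intervalIntegral.continuous_parametric_intervalIntegral_of_continuous hF
      continuous_snd).sub
      (intervalIntegral.continuous_parametric_intervalIntegral_of_continuous hF continuous_fst)

lemma intervalIntegral_triangle_swap {F : ℝ → ℝ → ℝ} (hF : Continuous (Function.uncurry F))
    {y x : ℝ} (hyx : y ≤ x) :
    ∫ s in y..x, ∫ r in y..s, F r s = ∫ r in y..x, ∫ s in r..x, F r s := by
  set T : Set (ℝ × ℝ) := {p | p.2 ≤ p.1} with hT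
  have hTm : MeasurableSet T := measurableSet_le measurable_snd measurable_fst
  have hG : Continuous fun p : ℝ × ℝ => F p.2 p.1 := hF.comp continuous_swap
  have hint : Integrable (Function.uncurry fun s r => T.indicator (fun p => F p.2 p.1) (s, r))
      ((volume.restrict (Ioc y x)).prod (volume.restrict (Ioc y x))) := by
    rw [Measure.prod_restrict]
    have h1 : IntegrableOn (fun p : ℝ × ℝ => F p.2 p.1) (Ioc y x ×ˢ Ioc y x)
        ((volume : Measure ℝ).prod volume) :=
      (hG.continuousOn.integrableOn_compact (isCompact_Icc.prod isCompact_Icc)).mono_set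
        (prod_mono Ioc_subset_Icc_self Ioc_subset_Icc_self)
    exact h1.indicator hTm
  have hsw := integral_integral_swap hint
  rw [intervalIntegral.integral_of_le hyx, intervalIntegral.integral_of_le hyx]
  have h1 : ∫ s in Ioc y x, ∫ r in y..s, F r s =
      ∫ s in Ioc y x, ∫ r in Ioc y x, T.indicator (fun p => F p.2 p.1) (s, r) := by
    refine setIntegral_congr_fun measurableSet_Ioc fun s hs => ?_
    have : (fun r => T.indicator (fun p => F p.2 p.1) (s, r)) =
        (Iic s).indicator fun r => F r s := by
      ext r; simp [Set.indicator, hT]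
    simp only [this]
    rw [setIntegral_indicator measurableSet_Iic, intervalIntegral.integral_of_le hs.1.le]
    congr 2
    ext r; simp only [mem_Ioc, mem_inter_iff, mem_Iic] at hs ⊢
    constructor
    · exact fun h => ⟨⟨h.1, h.2.trans hs.2⟩, h.2⟩
    · exact fun h => ⟨h.1.1, h.2⟩
  have h2 : ∫ r in Ioc y x, ∫ s in r..x, F r s =
      ∫ r in Ioc y x, ∫ s in Ioc y x, T.indicator (fun p => F p.2 p.1) (s, r) := by
    refine setIntegral_congr_fun measurableSet_Ioc fun r hr => ?_
    have : (fun s => T.indicator (fun p => F p.2 p.1) (s, r)) =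
        (Ici r).indicator fun s => F r s := by
      ext s; simp [Set.indicator, hT]
    simp only [this]
    rw [setIntegral_indicator measurableSet_Ici, intervalIntegral.integral_of_le hr.2,
      ← integral_Icc_eq_integral_Ioc]
    congr 2
    ext s; simp only [mem_Ioc, mem_inter_iff, mem_Ici, mem_Icc] at hr ⊢
    constructor
    · exact fun h => ⟨⟨hr.1.trans_le h.1, h.2⟩, h.1⟩
    · exact fun h => ⟨h.2, h.1.2⟩
  rw [h1, h2, hsw]

/-- The definition peels off the outermost weight, whereas differentiation in the lower limit `y`
needs the innermost one; Fubini on the triangle `y ≤ r ≤ s ≤ x` exchanges them. -/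
lemma nestedIntegral_concat (l : List (ℝ → ℝ)) (g : ℝ → ℝ) (hl : ∀ f ∈ l, Continuous f)
    (hg : Continuous g) {y x : ℝ} (hyx : y ≤ x) :
    nestedIntegral y (l ++ [g]) x = ∫ s in y..x, g s * nestedIntegral s l x := by
  induction l generalizing x with
  | nil => simp [nestedIntegral]
  | cons f l ih =>
    have hf : Continuous f := hl f (by simp)
    have hl' : ∀ f ∈ l, Continuous f := fun h hh => hl h (by simp [hh])
    have h1 : nestedIntegral y (f :: l ++ [g]) x =
        ∫ s in y..x, ∫ r in y..s, f s * (g r * nestedIntegral r l s) := by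
      change ∫ s in y..x, f s * nestedIntegral y (l ++ [g]) s = _
      refine intervalIntegral.integral_congr fun s hs => ?_
      rw [uIcc_of_le hyx] at hs
      rw [ih hl' hs.1, intervalIntegral.integral_const_mul]
    rw [h1, intervalIntegral_triangle_swap
      (F := fun r s => f s * (g r * nestedIntegral r l s)) _ hyx]
    · refine intervalIntegral.integral_congr fun r _ => ?_
      simp only [nestedIntegral]
      rw [← intervalIntegral.integral_const_mul]
      refine intervalIntegral.integral_congr fun s _ => ?_
      ring
    · exact (hf.comp continuous_snd).mul ((hg.comp continuous_fst).mul
        (continuous_nestedIntegral l hl'))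

/-! ### Dual functions and truncated kernel as primitives -/

section GlobalWeights

variable {w : ℕ → ℝ → ℝ}

lemma dualFun_one (m : ℕ) : dualFun w m 1 = fun _ => 1 := by
  ext y; simp [dualFun, nestedIntegral]

lemma dualFun_succ (m j : ℕ) (y : ℝ) :
    dualFun w (m + 1) (j + 2) y = ∫ s in (0 : ℝ)..y, w (m + 1) s * dualFun w m (j + 1) s := by
  have : (List.range (j + 2 - 1)).map (fun r => w (m + 1 - r)) =
      w (m + 1) :: (List.range (j + 1 - 1)).map (fun r => w (m - r)) := by
    rw [show j + 2 - 1 = j + 1 by omega, List.range_succ_eq_map]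
    simp [List.map_map, Function.comp_def]
  unfold dualFun
  rw [this]
  rfl

lemma continuous_dualFun (hw : ∀ j, Continuous (w j)) (m j : ℕ) : Continuous (dualFun w m j) :=
  (continuous_nestedIntegral _ (by simp only [List.mem_map]; rintro f ⟨r, -, rfl⟩; exact hw _)).comp
    (Continuous.prodMk_right (0 : ℝ))

lemma hasDerivAt_dualFun (hw : ∀ j, Continuous (w j)) (m j : ℕ) (y : ℝ) :
    HasDerivAt (dualFun w (m + 1) (j + 2)) (w (m + 1) y * dualFun w m (j + 1) y) y := by
  have hc : Continuous fun s => w (m + 1) s * dualFun w m (j + 1) s :=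
    (hw _).mul (continuous_dualFun hw _ _)
  rw [show dualFun w (m + 1) (j + 2) = _ from funext (dualFun_succ m j)]
  exact hc.integral_hasStrictDerivAt 0 y |>.hasDerivAt

lemma continuous_hFun (hw : ∀ j, Continuous (w j)) (m : ℕ) (x : ℝ) :
    Continuous fun y => hFun w m x y :=
  continuous_const.mul ((continuous_nestedIntegral _
    (by simp only [List.mem_map]; rintro f ⟨r, -, rfl⟩; exact hw _)).comp
      (Continuous.prodMk_left x))

lemma hFun_succ (hw : ∀ j, Continuous (w j)) {m : ℕ} (hm : 1 ≤ m) {x y : ℝ} (hyx : y ≤ x) :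
    hFun w (m + 1) x y = ∫ s in y..x, w (m + 1) s * hFun w m x s := by
  obtain ⟨m, rfl⟩ : ∃ n, m = n + 1 := ⟨m - 1, by omega⟩
  unfold hFun
  have : (List.range (m + 1 + 1 - 1)).map (fun r => w (r + 2)) =
      (List.range (m + 1 - 1)).map (fun r => w (r + 2)) ++ [w (m + 1 + 1)] := by
    rw [show m + 1 + 1 - 1 = m + 1 by omega, List.range_succ]
    simp
  rw [this, nestedIntegral_concat _ _ _ (hw _) hyx, ← intervalIntegral.integral_const_mul]
  · refine intervalIntegral.integral_congr fun s _ => ?_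
    ring
  · simp only [List.mem_map]; rintro f ⟨r, -, rfl⟩; exact hw _

lemma hFun_one (x y : ℝ) : hFun w 1 x y = w 1 x := by simp [hFun, nestedIntegral]

lemma hFun_self {m : ℕ} (hm : 2 ≤ m) (x : ℝ) : hFun w m x x = 0 := by
  obtain ⟨m, rfl⟩ : ∃ n, m = n + 2 := ⟨m - 2, by omega⟩
  simp [hFun, show m + 2 - 1 = m + 1 by omega, List.range_succ_eq_map, nestedIntegral]

lemma hasDerivWithinAt_hFun (hw : ∀ j, Continuous (w j)) {m : ℕ} (hm : 1 ≤ m) {x y : ℝ}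
    {s : Set ℝ} (hs : ∀ z ∈ s, z ≤ x) (hy : y ∈ s) :
    HasDerivWithinAt (fun y => hFun w (m + 1) x y) (-(w (m + 1) y * hFun w m x y)) s y := by
  have hc : Continuous fun s => w (m + 1) s * hFun w m x s := (hw _).mul (continuous_hFun hw _ _)
  have h1 : HasDerivAt (fun y => ∫ s in y..x, w (m + 1) s * hFun w m x s)
      (-(w (m + 1) y * hFun w m x y)) y :=
    intervalIntegral.integral_hasDerivAt_left (hc.intervalIntegrable _ _)
      hc.stronglyMeasurable.stronglyMeasurableAtFilter hc.continuousAt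
  exact h1.hasDerivWithinAt.congr (fun z hz => hFun_succ hw hm (hs z hz)) (hFun_succ hw hm (hs y hy))

lemma intervalIntegrable_mul_gFun (hw : ∀ j, Continuous (w j)) (i m : ℕ) (x a b : ℝ) :
    IntervalIntegrable (fun s => w i s * gFun w m x s) volume a b := by
  have h : (fun s => w i s * gFun w m x s) =
      (Iic x).indicator fun s => w i s * hFun w m x s := by
    ext s; simp only [gFun, Set.indicator, mem_Iic]; split_ifs <;> simp
  rw [h]
  have h2 := ((hw i).mul (continuous_hFun hw m x)).intervalIntegrable (μ := volume) a b
  exact ⟨h2.1.indicator measurableSet_Iic, h2.2.indicator measurableSet_Iic⟩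

/-- The truncation at `y = x` does not spoil the primitive, because `h_{m+1}(x, x) = 0` for `m ≥ 1`.
-/
lemma gFun_sub (hw : ∀ j, Continuous (w j)) {m : ℕ} (hm : 1 ≤ m) (x : ℝ) {a b : ℝ} (hab : a ≤ b) :
    gFun w (m + 1) x b - gFun w (m + 1) x a = -∫ s in a..b, w (m + 1) s * gFun w m x s := by
  have hc : Continuous fun s => w (m + 1) s * hFun w m x s := (hw _).mul (continuous_hFun hw _ _)
  have hle : ∀ c d, c ≤ d → d ≤ x → ∫ s in c..d, w (m + 1) s * gFun w m x s =
      ∫ s in c..d, w (m + 1) s * hFun w m x s := by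
    intro c d hcd hdx
    refine intervalIntegral.integral_congr fun s hs => ?_
    rw [uIcc_of_le hcd] at hs
    simp [gFun, hs.2.trans hdx]
  have hgt : ∀ c d, c ≤ d → x ≤ c → ∫ s in c..d, w (m + 1) s * gFun w m x s = 0 := by
    intro c d hcd hxc
    refine intervalIntegral.integral_zero_ae (Filter.Eventually.of_forall fun s hs => ?_)
    rw [uIoc_of_le hcd] at hs
    simp [gFun, (hxc.trans_lt hs.1)]
  rcases le_or_gt b x with hb | hb
  · rw [hle a b hab hb]
    simp only [gFun, hb, hab.trans hb, if_true]
    rw [hFun_succ hw hm hb, hFun_succ hw hm (hab.trans hb),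
      ← intervalIntegral.integral_add_adjacent_intervals (hc.intervalIntegrable a b)
        (hc.intervalIntegrable b x)]
    ring
  · rcases le_or_gt a x with ha | ha
    · rw [← intervalIntegral.integral_add_adjacent_intervals
        (intervalIntegrable_mul_gFun hw _ _ _ a x) (intervalIntegrable_mul_gFun hw _ _ _ x b),
        hle a x ha le_rfl, hgt x b hb.le le_rfl]
      simp only [gFun, hb.not_ge, ha, if_true, if_false]
      rw [hFun_succ hw hm ha]
      ring
    · rw [hgt a b hab ha.le]
      simp [gFun, hb.not_ge, ha.not_ge]

end GlobalWeights

end ChebSpline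

namespace ChebSpline

noncomputable section

/-! ### Confluent nodes and interlacing vectors -/

/-- The position of the node `r` inside its block of equal nodes, for `m + 1` nodes the first `p` of
which are `0`, the last `q` are `1`, and the others are distinct. -/
def blockIndex (p q m r : ℕ) : ℕ :=
  if r < p then r else if m + 1 ≤ r + q then r + q - (m + 1) else 0

/-- `m + 1` nodes in `[0,1]`, of which the first `p` are `0`, the last `q` are `1`, and the others
are strictly increasing inside `(0,1)`. -/
structure IsNodes (p q m : ℕ) (t : Fin (m + 1) → ℝ) : Prop where
  zero : ∀ r : Fin (m + 1), (r : ℕ) < p → t r = 0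
  one : ∀ r : Fin (m + 1), m + 1 ≤ r + q → t r = 1
  pos : ∀ r : Fin (m + 1), p ≤ r → 0 < t r
  lt_one : ∀ r : Fin (m + 1), r + q < m + 1 → t r < 1
  lt : ∀ r r' : Fin (m + 1), r < r' → p ≤ r' → r + q < m + 1 → t r < t r'

namespace IsNodes

variable {p q m : ℕ} {t : Fin (m + 1) → ℝ}

lemma nonneg (ht : IsNodes p q m t) (r : Fin (m + 1)) : 0 ≤ t r := by
  rcases lt_or_ge (r : ℕ) p with h | h
  · exact (ht.zero r h).ge
  · exact (ht.pos r h).le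

lemma le_one (ht : IsNodes p q m t) (r : Fin (m + 1)) : t r ≤ 1 := by
  rcases lt_or_ge ((r : ℕ) + q) (m + 1) with h | h
  · exact (ht.lt_one r h).le
  · exact (ht.one r h).le

lemma monotone (ht : IsNodes p q m t) : Monotone t := by
  intro r r' h
  rcases h.eq_or_lt with rfl | h
  · rfl
  rcases lt_or_ge (r' : ℕ) p with h1 | h1
  · rw [ht.zero r' h1, ht.zero r (lt_trans h h1)]
  rcases lt_or_ge ((r : ℕ) + q) (m + 1) with h2 | h2
  · exact (ht.lt r r' h h1 h2).le
  · rw [ht.one r h2]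
    exact (ht.one r' (h2.trans (Nat.add_le_add_right (Fin.lt_def.1 h).le q))).ge

lemma first_lt_last (ht : IsNodes p q m t) (hm : 1 ≤ m) (hp : p ≤ m) (hq : q ≤ m) :
    t 0 < t (Fin.last m) :=
  ht.lt _ _ (Fin.lt_def.2 (by simp; omega)) (by simpa using hp) (by simp; omega)

end IsNodes

/-- The gap between the nodes `r` and `r + 1` is degenerate: both are `0` or both are `1`. -/
abbrev DegenerateGap (p q m r : ℕ) : Prop := r + 1 < p ∨ m + 2 ≤ r + q

/-- The length measure on a gap, or the Dirac measure if the gap is degenerate. -/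
def gapMeasure (p q m : ℕ) (t : Fin (m + 2) → ℝ) (r : Fin (m + 1)) : Measure ℝ :=
  if DegenerateGap p q m r then Measure.dirac (t r.castSucc)
  else volume.restrict (Ioo (t r.castSucc) (t r.succ))

instance (p q m : ℕ) (t : Fin (m + 2) → ℝ) (r : Fin (m + 1)) :
    IsFiniteMeasure (gapMeasure p q m t r) := by
  unfold gapMeasure
  split_ifs <;> infer_instance

/-- The product of the gap measures: a measure on the vectors that interlace with `t`. -/
def interlacingMeasure (p q m : ℕ) (t : Fin (m + 2) → ℝ) : Measure (Fin (m + 1) → ℝ) :=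
  Measure.pi (gapMeasure p q m t)

instance (p q m : ℕ) (t : Fin (m + 2) → ℝ) : IsFiniteMeasure (interlacingMeasure p q m t) := by
  unfold interlacingMeasure
  infer_instance

/-- The product of the values of `f` over the nondegenerate gaps. -/
def gapWeight (p q m : ℕ) (f : ℝ → ℝ) (s : Fin (m + 1) → ℝ) : ℝ :=
  ∏ r : Fin (m + 1), if DegenerateGap p q m r then 1 else f (s r)

/-- The gaps are open, so almost every interlacing vector is strictly increasing away from the end
points. A node repeated `p` times bounds `p - 1` degenerate gaps, hence each multiplicity drops by
one (and stays `0` if it was `0`). -/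
lemma ae_interlacing {p q m : ℕ} {t : Fin (m + 2) → ℝ} (ht : IsNodes p q (m + 1) t) :
    ∀ᵐ s ∂interlacingMeasure p q m t, IsNodes (p - 1) (q - 1) m s ∧
      ∀ r : Fin (m + 1), t r.castSucc ≤ s r ∧ s r ≤ t r.succ := by
  have h1 : ∀ᵐ s ∂interlacingMeasure p q m t, ∀ r : Fin (m + 1),
      if DegenerateGap p q m r then s r = t r.castSucc
      else s r ∈ Ioo (t r.castSucc) (t r.succ) := by
    refine Filter.eventually_all.2 fun r => ?_
    refine (Measure.tendsto_eval_ae_ae (μ := gapMeasure p q m t) (i := r)).eventually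
      (p := fun y => if DegenerateGap p q m r then y = t r.castSucc
        else y ∈ Ioo (t r.castSucc) (t r.succ)) ?_
    unfold gapMeasure
    split_ifs
    · rw [ae_dirac_eq]; exact Filter.eventually_pure.2 rfl
    · exact ae_restrict_mem measurableSet_Ioo
  have htm := ht.monotone
  filter_upwards [h1] with s hs
  have hdeg : ∀ r : Fin (m + 1), DegenerateGap p q m r → s r = t r.castSucc := fun r hr => by
    have := hs r; rwa [if_pos hr] at this
  have hnd : ∀ r : Fin (m + 1), ¬ DegenerateGap p q m r →
      t r.castSucc < s r ∧ s r < t r.succ := fun r hr => by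
    have := hs r; rwa [if_neg hr] at this
  have hzero : ∀ r : Fin (m + 1), (r : ℕ) + 1 < p → s r = 0 := fun r hr => by
    rw [hdeg r (Or.inl hr)]
    exact ht.zero _ (by simp; omega)
  have hone : ∀ r : Fin (m + 1), m + 2 ≤ (r : ℕ) + q → s r = 1 := fun r hr => by
    rw [hdeg r (Or.inr hr)]
    exact ht.one _ (by simp; omega)
  have hpos : ∀ r : Fin (m + 1), p ≤ (r : ℕ) + 1 → 0 < s r := fun r hr => by
    by_cases h : DegenerateGap p q m r
    · rw [hone r (by rcases h with h | h <;> omega)]; exact one_pos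
    · exact (ht.nonneg _).trans_lt (hnd r h).1
  have hlt : ∀ r : Fin (m + 1), (r : ℕ) + q < m + 2 → s r < 1 := fun r hr => by
    by_cases h : DegenerateGap p q m r
    · rw [hzero r (by rcases h with h | h <;> omega)]; exact one_pos
    · exact (hnd r h).2.trans_le (ht.le_one _)
  refine ⟨⟨fun r hr => hzero r (by omega), fun r hr => hone r (by omega),
    fun r hr => hpos r (by omega), fun r hr => hlt r (by omega), fun r r' hrr hr' hr => ?_⟩,
    fun r => ?_⟩
  · rw [Fin.lt_def] at hrr
    by_cases h' : DegenerateGap p q m r'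
    · rw [hone r' (by rcases h' with h | h <;> omega)]
      exact hlt r (by omega)
    by_cases h : DegenerateGap p q m r
    · rw [hzero r (by rcases h with h | h <;> omega)]
      exact hpos r' (by omega)
    · refine (hnd r h).2.trans_le (le_trans (htm ?_) (hnd r' h').1.le)
      rw [Fin.le_def]; simp; omega
  · by_cases h : DegenerateGap p q m r
    · rw [hdeg r h]
      exact ⟨le_rfl, htm (Fin.castSucc_le_succ r)⟩
    · exact ⟨(hnd r h).1.le, (hnd r h).2.le⟩

/-! ### Reduction of the order of the determinant -/

/-- The confluent collocation matrix of a family of functions `E m j` that is closed under the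
adapted derivative `E (m + 1) (j + 1) ↦ E m j`. -/
def blockMatrix (E : ℕ → ℕ → ℝ → ℝ) (p q m : ℕ) (t : Fin (m + 1) → ℝ) :
    Matrix (Fin (m + 1)) (Fin (m + 1)) ℝ :=
  Matrix.of fun r j => if blockIndex p q m r ≤ j then
    E (m - blockIndex p q m r) (j - blockIndex p q m r) (t r) else 0

/-- `E m 0 = 1`, and `E (m + 1) (j + 1)` is a primitive of `w (m + 1) * E m j`. -/
structure IsIntegralFamily (w : ℕ → ℝ → ℝ) (E : ℕ → ℕ → ℝ → ℝ) : Prop where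
  zero : ∀ m y, 1 ≤ m → E m 0 y = 1
  -- Order `m = 0` is excluded: `g_1(x, ·)` jumps at `x` and is not a primitive. Its jump enters
  -- only through the base case.
  sub : ∀ m j a b, 1 ≤ m → j ≤ m → a ≤ b →
    E (m + 1) (j + 1) b - E (m + 1) (j + 1) a = ∫ s in a..b, w (m + 1) s * E m j s
  integrable : ∀ m j a b, IntervalIntegrable (fun s => w (m + 1) s * E m j s) volume a b

/-- Row `r` depends on the variable `s r` alone, so each term of the Leibniz expansion is a product
of functions of separate variables. -/
lemma det_integral_eq {m : ℕ} (μ : Fin m → Measure ℝ) [∀ r, SigmaFinite (μ r)]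
    (f : Fin m → Fin m → ℝ → ℝ) (hf : ∀ r j, Integrable (f r j) (μ r)) :
    Integrable (fun s : Fin m → ℝ => (Matrix.of fun r j => f r j (s r)).det) (Measure.pi μ) ∧
    (Matrix.of fun r j => ∫ s, f r j s ∂μ r).det =
      ∫ s : Fin m → ℝ, (Matrix.of fun r j => f r j (s r)).det ∂Measure.pi μ := by
  have hi : ∀ σ : Equiv.Perm (Fin m), Integrable
      (fun s : Fin m → ℝ => ((Equiv.Perm.sign σ : ℤ) : ℝ) * ∏ r, f r (σ r) (s r))
      (Measure.pi μ) := fun σ =>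
    (Integrable.fintype_prod (f := fun r => f r (σ r)) fun r => hf r (σ r)).const_mul _
  have he : ∀ s : Fin m → ℝ, (Matrix.of fun r j => f r j (s r)).det =
      ∑ σ : Equiv.Perm (Fin m), ((Equiv.Perm.sign σ : ℤ) : ℝ) * ∏ r, f r (σ r) (s r) := fun s => by
    rw [← Matrix.det_transpose, Matrix.det_apply']
    rfl
  simp_rw [he]
  refine ⟨integrable_finsetSum _ fun σ _ => hi σ, ?_⟩
  rw [integral_finsetSum _ fun σ _ => hi σ, ← Matrix.det_transpose, Matrix.det_apply']
  refine Finset.sum_congr rfl fun σ _ => ?_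
  rw [integral_const_mul, integral_fintype_prod_eq_prod (fun r => f r (σ r))]
  rfl

section Reduction

variable {w : ℕ → ℝ → ℝ} {E : ℕ → ℕ → ℝ → ℝ} {p q m : ℕ} {t : Fin (m + 2) → ℝ}

/-- The rows of the matrix after the subtraction of neighbouring rows. -/
lemma blockMatrix_det_eq_minor (hE : IsIntegralFamily w E) (hq : q ≤ m + 1)
    (ht : IsNodes p q (m + 1) t) :
    (blockMatrix E p q (m + 1) t).det = (Matrix.of fun r j : Fin (m + 1) =>
      if DegenerateGap p q m r then blockMatrix E p q (m + 1) t r.succ j.succ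
      else E (m + 1) (j + 1) (t r.succ) - E (m + 1) (j + 1) (t r.castSucc)).det := by
  set A := blockMatrix E p q (m + 1) t with hA
  have hA0 : ∀ r : Fin (m + 2), blockIndex p q (m + 1) r = 0 → ∀ j, A r j = E (m + 1) j (t r) := by
    intro r hr j
    simp [hA, blockMatrix, hr]
  have hA0' : ∀ r : Fin (m + 2), blockIndex p q (m + 1) r ≠ 0 → A r 0 = 0 := by
    intro r hr
    simp [hA, blockMatrix, hr]
  have hidx0 : blockIndex p q (m + 1) (0 : Fin (m + 2)) = 0 := by
    have : blockIndex p q (m + 1) 0 = 0 := by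
      unfold blockIndex; split_ifs <;> omega
    exact this
  let B : Matrix (Fin (m + 2)) (Fin (m + 2)) ℝ := Matrix.of fun r j =>
    Fin.cases (A 0 j) (fun r' : Fin (m + 1) => if DegenerateGap p q m r' then A r'.succ j
      else E (m + 1) j (t r'.succ) - E (m + 1) j (t r'.castSucc)) r
  -- Intermediate matrix: differences are taken only where the left neighbour carries function
  -- values.
  let A' : Matrix (Fin (m + 2)) (Fin (m + 2)) ℝ := Matrix.of fun r j =>
    Fin.cases (A 0 j) (fun r' : Fin (m + 1) => if DegenerateGap p q m r' then A r'.succ j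
      else if blockIndex p q (m + 1) r'.castSucc = 0 then A r'.succ j - A r'.castSucc j
      else A r'.succ j) r
  have h1 : A.det = A'.det := by
    refine Matrix.det_eq_of_forall_row_eq_smul_add_pred
      (fun r => if DegenerateGap p q m r then 0 else
        if blockIndex p q (m + 1) r.castSucc = 0 then 1 else 0) (fun j => rfl) fun r j => ?_
    simp only [A', Matrix.of_apply, Fin.cases_succ]
    split_ifs <;> ring
  have hnd : ∀ r : Fin (m + 1), ¬ DegenerateGap p q m r →
      blockIndex p q (m + 1) r.succ = 0 := by
    intro r hr
    simp only [not_or, not_lt, not_le] at hr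
    simp only [blockIndex, Fin.val_succ]; split_ifs <;> omega
  -- In a nondegenerate gap the left neighbour is a derivative row only if it is the last of several
  -- nodes at `0`. The function values at `0` then stand in row `0`, which is subtracted instead.
  have h2 : A'.det = B.det := by
    refine Matrix.det_eq_of_forall_row_eq_smul_add_const
      (fun r => Fin.cases 0 (fun r' : Fin (m + 1) => if DegenerateGap p q m r' then 0 else
        if blockIndex p q (m + 1) r'.castSucc = 0 then 0 else 1) r) 0 rfl fun r j => ?_
    refine Fin.cases ?_ (fun r' => ?_) r
    · simp [A', B]
    · simp only [A', B, Matrix.of_apply, Fin.cases_succ, Fin.cases_zero]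
      by_cases hd : DegenerateGap p q m r'
      · simp [hd]
      · rw [if_neg hd, if_neg hd, if_neg hd, hA0 _ (hnd r' hd)]
        split_ifs with h
        · rw [hA0 _ h]; ring
        · rw [hA0 0 hidx0]
          have hlt : (r' : ℕ) < p := by
            simp only [not_or, not_lt, not_le] at hd
            by_contra hlt
            apply h
            simp only [blockIndex, Fin.val_castSucc]; split_ifs; omega; rfl
          rw [ht.zero r'.castSucc (by simpa using hlt), ht.zero 0 (by simp; omega)]
          ring
  rw [h1, h2, Matrix.det_succ_column_zero, Fin.sum_univ_succ, Finset.sum_eq_zero, add_zero]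
  · have hB00 : B 0 0 = 1 := by
      change A 0 0 = 1
      rw [hA0 0 hidx0]; exact hE.zero _ _ (by omega)
    rw [hB00]
    simp only [Fin.val_zero, pow_zero, one_mul, Fin.succAbove_zero]
    rfl
  · intro r _
    have hB : B r.succ 0 = 0 := by
      simp only [B, Matrix.of_apply, Fin.cases_succ]
      split_ifs with hd
      · refine hA0' _ ?_
        simp only [blockIndex, Fin.val_succ]
        rcases hd with hd | hd
        · rw [if_pos hd]; omega
        · have : ¬ ((r : ℕ) + 1 < p) := by
            intro h
            have h1 := ht.zero r.succ (by simpa using h)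
            have h2 := ht.one r.succ (by simp; omega)
            rw [h1] at h2; exact zero_ne_one h2
          rw [if_neg this, if_pos (by omega)]; omega
      · simp [hE.zero]
    rw [hB]; ring

/-- After row subtraction each row is an integral over its own gap, or a point evaluation if the gap
is degenerate. Multilinearity pulls all these integrals in front of the determinant. -/
lemma blockMatrix_det_succ (hE : IsIntegralFamily w E) (hm : 1 ≤ m) (hq : q ≤ m + 1)
    (ht : IsNodes p q (m + 1) t) :
    Integrable (fun s => gapWeight p q m (w (m + 1)) s *
      (blockMatrix E (p - 1) (q - 1) m s).det) (interlacingMeasure p q m t) ∧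
    (blockMatrix E p q (m + 1) t).det = ∫ s, gapWeight p q m (w (m + 1)) s *
      (blockMatrix E (p - 1) (q - 1) m s).det ∂interlacingMeasure p q m t := by
  let d : Fin (m + 1) → ℕ := fun r => blockIndex (p - 1) (q - 1) m r
  let f : Fin (m + 1) → Fin (m + 1) → ℝ → ℝ := fun r j y =>
    (if DegenerateGap p q m r then 1 else w (m + 1) y) *
      (if d r ≤ j then E (m - d r) (j - d r) y else 0)
  have hdet : ∀ s : Fin (m + 1) → ℝ, gapWeight p q m (w (m + 1)) s *
      (blockMatrix E (p - 1) (q - 1) m s).det = (Matrix.of fun r j => f r j (s r)).det := by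
    intro s
    exact (Matrix.det_mul_column (fun r : Fin (m + 1) => if DegenerateGap p q m r then 1
      else w (m + 1) (s r)) (blockMatrix E (p - 1) (q - 1) m s)).symm
  have hd0 : ∀ r : Fin (m + 1), ¬ DegenerateGap p q m r → d r = 0 := by
    intro r hr
    simp only [not_or, not_lt, not_le] at hr
    simp only [d, blockIndex]; split_ifs <;> omega
  have hf : ∀ r j, Integrable (f r j) (gapMeasure p q m t r) := by
    intro r j
    unfold gapMeasure
    split_ifs with hr
    · exact integrable_dirac (by simp)
    · simp only [f, hd0 r hr, if_neg hr, Nat.zero_le, if_true, Nat.sub_zero]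
      have := (hE.integrable m j (t r.castSucc) (t r.succ)).1
      exact this.mono_set Ioo_subset_Ioc_self
  obtain ⟨h1, h2⟩ := det_integral_eq (gapMeasure p q m t) f hf
  simp_rw [hdet]
  refine ⟨h1, ?_⟩
  unfold interlacingMeasure
  rw [← h2, blockMatrix_det_eq_minor hE hq ht]
  congr 1
  ext r j
  simp only [Matrix.of_apply]
  unfold gapMeasure
  split_ifs with hr
  · rw [integral_dirac]
    simp only [f, if_pos hr, one_mul, blockMatrix, Matrix.of_apply]
    have hidx : blockIndex p q (m + 1) r.succ = d r + 1 := by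
      simp only [d, blockIndex, Fin.val_succ]
      rcases hr with hr | hr
      · rw [if_pos hr, if_pos (by omega)]
      · have : ¬ ((r : ℕ) + 1 < p) := by
          intro h
          have h1 := ht.zero r.succ (by simpa using h)
          have h2 := ht.one r.succ (by simp; omega)
          rw [h1] at h2; exact zero_ne_one h2
        split_ifs <;> omega
    have htt : t r.succ = t r.castSucc := by
      rcases hr with hr | hr
      · rw [ht.zero r.succ (by simpa using hr), ht.zero r.castSucc (by simp; omega)]
      · rw [ht.one r.succ (by simp; omega), ht.one r.castSucc (by simp; omega)]
    rw [hidx, htt]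
    simp only [Fin.val_succ, add_le_add_iff_right, Nat.add_sub_add_right]
  · simp only [f, hd0 r hr, if_neg hr, Nat.zero_le, if_true, Nat.sub_zero]
    rw [hE.sub m j _ _ hm (Nat.lt_succ_iff.1 j.2) (ht.monotone (Fin.castSucc_le_succ r)),
      intervalIntegral.integral_of_le (ht.monotone (Fin.castSucc_le_succ r)),
      integral_Ioc_eq_integral_Ioo]

end Reduction

lemma blockMatrix_det_one {w : ℕ → ℝ → ℝ} {E : ℕ → ℕ → ℝ → ℝ} (hE : IsIntegralFamily w E)
    {p q : ℕ} (hp : p ≤ 1) (hq : q ≤ 1) (t : Fin 2 → ℝ) :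
    (blockMatrix E p q 1 t).det = E 1 1 (t 1) - E 1 1 (t 0) := by
  have h0 : blockIndex p q 1 0 = 0 := by unfold blockIndex; split_ifs <;> omega
  have h1 : blockIndex p q 1 1 = 0 := by unfold blockIndex; split_ifs <;> omega
  rw [Matrix.det_fin_two]
  simp [blockMatrix, h0, h1, hE.zero]

lemma gapWeight_nonneg (p q m : ℕ) {f : ℝ → ℝ} (hf : ∀ y, 0 ≤ f y) (s : Fin (m + 1) → ℝ) :
    0 ≤ gapWeight p q m f s :=
  Finset.prod_nonneg fun r _ => by split_ifs; exacts [zero_le_one, hf _]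

lemma gapWeight_pos (p q m : ℕ) {f : ℝ → ℝ} (hf : ∀ y, 0 < f y) (s : Fin (m + 1) → ℝ) :
    0 < gapWeight p q m f s :=
  Finset.prod_pos fun r _ => by split_ifs; exacts [zero_lt_one, hf _]

lemma gapWeight_one (p q m : ℕ) (s : Fin (m + 1) → ℝ) : gapWeight p q m (fun _ => 1) s = 1 :=
  Finset.prod_eq_one fun r _ => by split_ifs <;> rfl

/-! ### Positivity and monotonicity of the determinants -/

section Positivity

variable {w : ℕ → ℝ → ℝ} {E : ℕ → ℕ → ℝ → ℝ}

lemma blockMatrix_det_nonneg (hE : IsIntegralFamily w E) (hw : ∀ j y, 0 ≤ w j y)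
    (h1 : Monotone (E 1 1)) {m : ℕ} (hm : 1 ≤ m) :
    ∀ {p q : ℕ}, p ≤ m → q ≤ m → ∀ {t : Fin (m + 1) → ℝ}, IsNodes p q m t →
      0 ≤ (blockMatrix E p q m t).det := by
  induction m, hm using Nat.le_induction with
  | base =>
    intro p q hp hq t ht
    rw [blockMatrix_det_one hE hp hq]
    exact sub_nonneg.2 (h1 (ht.monotone (Fin.zero_le _)))
  | succ m hm ih =>
    intro p q hp hq t ht
    rw [(blockMatrix_det_succ hE hm hq ht).2]
    refine integral_nonneg_of_ae ?_
    filter_upwards [ae_interlacing ht] with s hs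
    exact mul_nonneg (gapWeight_nonneg _ _ _ (hw _) _) (ih (by omega) (by omega) hs.1)

/-- The event contains a box that restricts only the first and last coordinates (distinct because `m
≥ 1`), and every side of the box has positive gap measure. -/
lemma interlacingMeasure_straddle_pos {p q m : ℕ} (hm : 1 ≤ m) {t : Fin (m + 2) → ℝ}
    (ht : IsNodes p q (m + 1) t) {x : ℝ} (h0 : t 0 < x) (h1 : x < t (Fin.last (m + 1))) :
    0 < interlacingMeasure p q m t {s | s 0 < x ∧ x < s (Fin.last m)} := by
  let B : Fin (m + 1) → Set ℝ := fun r =>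
    if r = 0 then Iio x else if r = Fin.last m then Ioi x else univ
  have hne : (0 : Fin (m + 1)) ≠ Fin.last m := by
    intro h; have := congrArg Fin.val h; simp at this; omega
  have hB : Set.pi univ B ⊆ {s | s 0 < x ∧ x < s (Fin.last m)} := by
    intro s hs
    have a := hs 0 (mem_univ _)
    have b := hs (Fin.last m) (mem_univ _)
    simp only [B, if_true, mem_Iio] at a
    simp only [B, if_neg hne.symm, if_true, mem_Ioi] at b
    exact ⟨a, b⟩
  refine lt_of_lt_of_le ?_ (measure_mono hB)
  unfold interlacingMeasure
  rw [Measure.pi_pi]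
  rw [pos_iff_ne_zero, Finset.prod_ne_zero_iff]
  intro r _
  have hdeg : DegenerateGap p q m r → t r.castSucc = t r.succ := by
    intro hr
    rcases hr with hr | hr
    · rw [ht.zero r.succ (by simpa using hr), ht.zero r.castSucc (by simp; omega)]
    · rw [ht.one r.succ (by simp; omega), ht.one r.castSucc (by simp; omega)]
  have hlt : ¬ DegenerateGap p q m r → t r.castSucc < t r.succ := by
    intro hr
    simp only [not_or, not_lt, not_le] at hr
    exact ht.lt _ _ (Fin.castSucc_lt_succ) (by simp; omega) (by simp; omega)
  have hB0 : r = 0 → t r.castSucc < x := by rintro rfl; exact h0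
  have hB1 : r = Fin.last m → x < t r.succ := by rintro rfl; exact h1
  unfold gapMeasure
  split_ifs with hr
  · have hmem : t r.castSucc ∈ B r := by
      simp only [B]
      split_ifs with c1 c2
      · exact hB0 c1
      · rw [hdeg hr]; exact hB1 c2
      · trivial
    rw [Measure.dirac_apply_of_mem hmem]
    exact one_ne_zero
  · rw [Measure.restrict_apply' measurableSet_Ioo]
    refine ne_of_gt ?_
    simp only [B]
    split_ifs with c1 c2
    · rw [inter_comm, Ioo_inter_Iio, Real.volume_Ioo, ENNReal.ofReal_pos]
      exact sub_pos.2 (lt_min (hlt hr) (hB0 c1))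
    · rw [Ioi_inter_Ioo, Real.volume_Ioo, ENNReal.ofReal_pos]
      exact sub_pos.2 (max_lt (hB1 c2) (hlt hr))
    · rw [univ_inter, Real.volume_Ioo, ENNReal.ofReal_pos]
      exact sub_pos.2 (hlt hr)

/-- A point of increase of `E 1 1` strictly between the extreme nodes is still straddled by a set of
interlacing vectors of positive measure, so positivity passes up the recursion. -/
lemma blockMatrix_det_pos (hE : IsIntegralFamily w E) (hw : ∀ j y, 0 < w j y)
    (h1 : Monotone (E 1 1)) {x : ℝ} (hx : ∀ a b, a < x → x < b → E 1 1 a < E 1 1 b)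
    {m : ℕ} (hm : 1 ≤ m) :
    ∀ {p q : ℕ}, p ≤ m → q ≤ m → ∀ {t : Fin (m + 1) → ℝ}, IsNodes p q m t →
      t 0 < x → x < t (Fin.last m) → 0 < (blockMatrix E p q m t).det := by
  induction m, hm using Nat.le_induction with
  | base =>
    intro p q hp hq t ht hx0 hx1
    rw [blockMatrix_det_one hE hp hq]
    exact sub_pos.2 (hx _ _ hx0 hx1)
  | succ m hm ih =>
    intro p q hp hq t ht hx0 hx1
    obtain ⟨hi, he⟩ := blockMatrix_det_succ hE hm hq ht
    have hae := ae_interlacing ht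
    rw [he, integral_pos_iff_support_of_nonneg_ae _ hi]
    · refine (interlacingMeasure_straddle_pos hm ht hx0 hx1).trans_le (measure_mono_ae ?_)
      filter_upwards [hae] with s hs hsx
      exact (mul_pos (gapWeight_pos _ _ _ (hw _) _)
        (ih (by omega) (by omega) hs.1 hsx.1 hsx.2)).ne'
    · filter_upwards [hae] with s hs
      exact mul_nonneg (gapWeight_nonneg _ _ _ (fun y => (hw _ y).le) _)
        (blockMatrix_det_nonneg hE (fun j y => (hw j y).le) h1 hm (by omega) (by omega) hs.1)

/-- Moving the first node to the left and the last one to the right increases the determinant. -/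
lemma blockMatrix_det_mono (hE : IsIntegralFamily w E) (hw : ∀ j y, 0 ≤ w j y)
    (h1 : Monotone (E 1 1)) {m p q : ℕ} (hm : 1 ≤ m) (hp : p ≤ m) (hq : q ≤ m)
    {s t : Fin (m + 1) → ℝ} (hs : IsNodes p q m s) (ht : IsNodes p q m t)
    (h0 : t 0 ≤ s 0) (hlast : s (Fin.last m) ≤ t (Fin.last m))
    (hst : ∀ r, r ≠ 0 → r ≠ Fin.last m → s r = t r) :
    (blockMatrix E p q m s).det ≤ (blockMatrix E p q m t).det := by
  obtain rfl | ⟨m, hm', rfl⟩ : m = 1 ∨ ∃ n, 1 ≤ n ∧ m = n + 1 := by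
    rcases hm.eq_or_lt with h | h
    · exact Or.inl h.symm
    · exact Or.inr ⟨m - 1, by omega, by omega⟩
  · rw [blockMatrix_det_one hE hp hq, blockMatrix_det_one hE hp hq]
    exact sub_le_sub (h1 hlast) (h1 h0)
  · obtain ⟨_, hse⟩ := blockMatrix_det_succ hE hm' hq hs
    obtain ⟨hti, hte⟩ := blockMatrix_det_succ hE hm' hq ht
    have hle : ∀ r : Fin (m + 1), t r.castSucc ≤ s r.castSucc := by
      intro r
      rcases eq_or_ne r 0 with rfl | hr
      · exact h0
      · exact (hst _ (by simpa using hr) (Fin.castSucc_lt_last r).ne).ge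
    have hge : ∀ r : Fin (m + 1), s r.succ ≤ t r.succ := by
      intro r
      rcases eq_or_ne r (Fin.last m) with rfl | hr
      · exact hlast
      · exact (hst _ (Fin.succ_ne_zero r) (by simpa [← Fin.succ_last] using hr)).le
    -- Moving the extreme nodes outwards only enlarges the gaps, so the measure for `s` is a
    -- restriction of the one for `t`; the integrand is nonnegative.
    have hμ : interlacingMeasure p q m s = (interlacingMeasure p q m t).restrict
        (Set.pi univ fun r => if DegenerateGap p q m r then univ
          else Ioo (s r.castSucc) (s r.succ)) := by
      unfold interlacingMeasure
      rw [Measure.restrict_pi_pi]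
      congr 1
      ext1 r
      unfold gapMeasure
      split_ifs with hr
      · rw [Measure.restrict_univ]
        rcases hr with hr | hr
        · rw [hs.zero _ (by simp; omega), ht.zero _ (by simp; omega)]
        · rw [hs.one _ (by simp; omega), ht.one _ (by simp; omega)]
      · rw [Measure.restrict_restrict measurableSet_Ioo,
          inter_eq_left.2 (Ioo_subset_Ioo (hle r) (hge r))]
    rw [hse, hte, hμ]
    refine setIntegral_le_integral hti ?_
    filter_upwards [ae_interlacing ht] with u hu
    exact mul_nonneg (gapWeight_nonneg _ _ _ (hw _) _)
      (blockMatrix_det_nonneg hE hw h1 hm' (by omega) (by omega) hu.1)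

end Positivity

/-! ### Comparison with constant weights -/

/-- The power product of the reference values `a j` by which a determinant of size `m + 1` with
weights close to `a j` differs from the one with weights `1`. -/
def scaleFactor (a : ℕ → ℝ) : ℕ → ℕ → ℕ → ℝ
  | _, _, 0 => a 1
  | p, q, m + 1 => (∏ r : Fin (m + 2), if DegenerateGap p q (m + 1) r then 1 else a (m + 2)) *
      scaleFactor a (p - 1) (q - 1) m

lemma scaleFactor_pos {a : ℕ → ℝ} (ha : ∀ j, 0 < a j) (p q m : ℕ) : 0 < scaleFactor a p q m := by
  induction m generalizing p q with
  | zero => exact ha 1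
  | succ m ih =>
    exact mul_pos (Finset.prod_pos fun r _ => by split_ifs; exacts [one_pos, ha _]) (ih _ _)

lemma gapWeight_le {p q m : ℕ} {f : ℝ → ℝ} {a θ α β : ℝ} (hθ : 1 ≤ θ) (hf : ∀ y, 0 ≤ f y)
    (h : ∀ y ∈ Icc α β, f y ≤ θ * a) {s : Fin (m + 1) → ℝ} (hs : ∀ r, s r ∈ Icc α β) :
    gapWeight p q m f s ≤
      θ ^ (m + 1) * ∏ r : Fin (m + 1), if DegenerateGap p q m r then 1 else a := by
  have : θ ^ (m + 1) * ∏ r : Fin (m + 1), (if DegenerateGap p q m r then 1 else a) =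
      ∏ r : Fin (m + 1), θ * (if DegenerateGap p q m r then 1 else a) := by
    rw [Finset.prod_mul_distrib, Finset.prod_const, Finset.card_univ, Fintype.card_fin]
  rw [this]
  refine Finset.prod_le_prod (fun r _ => ?_) fun r _ => ?_
  · split_ifs; exacts [zero_le_one, hf _]
  · split_ifs
    · linarith
    · exact h _ (hs r)

lemma le_gapWeight {p q m : ℕ} {f : ℝ → ℝ} {a θ α β : ℝ} (hθ : 1 ≤ θ) (ha : 0 ≤ a)
    (h : ∀ y ∈ Icc α β, a ≤ θ * f y) {s : Fin (m + 1) → ℝ} (hs : ∀ r, s r ∈ Icc α β) :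
    (∏ r : Fin (m + 1), if DegenerateGap p q m r then 1 else a) ≤
      θ ^ (m + 1) * gapWeight p q m f s := by
  have : θ ^ (m + 1) * gapWeight p q m f s =
      ∏ r : Fin (m + 1), θ * (if DegenerateGap p q m r then 1 else f (s r)) := by
    rw [Finset.prod_mul_distrib, Finset.prod_const, Finset.card_univ, Fintype.card_fin]
    rfl
  rw [this]
  refine Finset.prod_le_prod (fun r _ => ?_) fun r _ => ?_
  · split_ifs; exacts [zero_le_one, ha]
  · split_ifs
    · linarith
    · exact h _ (hs r)

/-- All integrands in the recursion are nonnegative, so two-sided multiplicative bounds on the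
weights and on the increments of `E 1 1` integrate. The factor `scaleFactor` does not depend on the
family, which is what lets it cancel in the quotient. -/
lemma blockMatrix_det_compare {w : ℕ → ℝ → ℝ} {E E' : ℕ → ℕ → ℝ → ℝ} (hE : IsIntegralFamily w E)
    (hE' : IsIntegralFamily (fun _ _ => 1) E') (hw : ∀ j y, 0 ≤ w j y)
    (h1 : Monotone (E 1 1)) (h1' : Monotone (E' 1 1)) {a : ℕ → ℝ} {θ α β : ℝ} (hθ : 1 ≤ θ)
    (ha : ∀ j, 0 < a j) {k : ℕ}
    (hle : ∀ j, 1 ≤ j → j ≤ k → ∀ y ∈ Icc α β, w j y ≤ θ * a j)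
    (hge : ∀ j, 1 ≤ j → j ≤ k → ∀ y ∈ Icc α β, a j ≤ θ * w j y)
    (hb : ∀ c ∈ Icc α β, ∀ d ∈ Icc α β, c ≤ d →
      a 1 * (E' 1 1 d - E' 1 1 c) ≤ θ * (E 1 1 d - E 1 1 c) ∧
      E 1 1 d - E 1 1 c ≤ θ * (a 1 * (E' 1 1 d - E' 1 1 c)))
    {m : ℕ} (hmk : m + 1 ≤ k) :
    ∀ {p q : ℕ}, p ≤ m + 1 → q ≤ m + 1 → ∀ {t : Fin (m + 2) → ℝ}, IsNodes p q (m + 1) t →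
      (∀ r, t r ∈ Icc α β) →
      scaleFactor a p q m * (blockMatrix E' p q (m + 1) t).det ≤
        θ ^ ((m + 1) ^ 2) * (blockMatrix E p q (m + 1) t).det ∧
      (blockMatrix E p q (m + 1) t).det ≤
        θ ^ ((m + 1) ^ 2) * (scaleFactor a p q m * (blockMatrix E' p q (m + 1) t).det) := by
  have hθ0 : 0 ≤ θ := zero_le_one.trans hθ
  induction m with
  | zero =>
    intro p q hp hq t ht htI
    rw [blockMatrix_det_one hE hp hq, blockMatrix_det_one hE' hp hq]
    simpa [scaleFactor] using hb _ (htI 0) _ (htI 1) (ht.monotone (Fin.zero_le _))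
  | succ m ih =>
    intro p q hp hq t ht htI
    obtain ⟨hi, he⟩ := blockMatrix_det_succ hE (Nat.le_add_left 1 m) hq ht
    obtain ⟨hi', he'⟩ := blockMatrix_det_succ hE' (Nat.le_add_left 1 m) hq ht
    simp only [gapWeight_one, one_mul] at hi' he'
    rw [he, he']
    have hae := ae_interlacing ht
    set P : ℝ := ∏ r : Fin (m + 2), if DegenerateGap p q (m + 1) r then 1 else a (m + 2) with hP
    have hP0 : 0 < P := Finset.prod_pos fun r _ => by split_ifs; exacts [one_pos, ha _]
    have hA0 := scaleFactor_pos ha (p - 1) (q - 1) m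
    have hsf : scaleFactor a p q (m + 1) = P * scaleFactor a (p - 1) (q - 1) m := rfl
    -- A level adds at most one `θ` per coordinate, and `(m + 2) + (m + 1)^2 ≤ (m + 2)^2`.
    have hexp : θ ^ (m + 2) * θ ^ ((m + 1) ^ 2) ≤ θ ^ ((m + 1 + 1) ^ 2) := by
      rw [← pow_add]
      exact pow_le_pow_right₀ hθ (by nlinarith)
    have key : ∀ᵐ s ∂interlacingMeasure p q (m + 1) t,
        P * scaleFactor a (p - 1) (q - 1) m * (blockMatrix E' (p - 1) (q - 1) (m + 1) s).det ≤
          θ ^ ((m + 1 + 1) ^ 2) * (gapWeight p q (m + 1) (w (m + 1 + 1)) s *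
            (blockMatrix E (p - 1) (q - 1) (m + 1) s).det) ∧
        gapWeight p q (m + 1) (w (m + 1 + 1)) s *
            (blockMatrix E (p - 1) (q - 1) (m + 1) s).det ≤ θ ^ ((m + 1 + 1) ^ 2) *
          (P * scaleFactor a (p - 1) (q - 1) m *
            (blockMatrix E' (p - 1) (q - 1) (m + 1) s).det) := by
      filter_upwards [hae] with s hs
      have hsI : ∀ r, s r ∈ Icc α β := fun r =>
        ⟨(htI _).1.trans (hs.2 r).1, (hs.2 r).2.trans (htI _).2⟩
      obtain ⟨i1, i2⟩ := ih (by omega) (by omega) (by omega) hs.1 hsI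
      have g1 : gapWeight p q (m + 1) (w (m + 2)) s ≤ θ ^ (m + 2) * P :=
        gapWeight_le hθ (hw _) (hle (m + 2) (by omega) hmk) hsI
      have g2 : P ≤ θ ^ (m + 2) * gapWeight p q (m + 1) (w (m + 2)) s :=
        le_gapWeight hθ (ha _).le (hge (m + 2) (by omega) hmk) hsI
      have g0 := gapWeight_nonneg p q (m + 1) (hw (m + 2)) s
      have d0 := blockMatrix_det_nonneg hE hw h1 (Nat.le_add_left 1 m)
        (show p - 1 ≤ m + 1 by omega) (show q - 1 ≤ m + 1 by omega) hs.1
      have d0' := blockMatrix_det_nonneg hE' (fun _ _ => zero_le_one) h1' (Nat.le_add_left 1 m)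
        (show p - 1 ≤ m + 1 by omega) (show q - 1 ≤ m + 1 by omega) hs.1
      constructor
      · calc _ = P * (scaleFactor a (p - 1) (q - 1) m *
              (blockMatrix E' (p - 1) (q - 1) (m + 1) s).det) := by ring
          _ ≤ (θ ^ (m + 2) * gapWeight p q (m + 1) (w (m + 2)) s) *
              (θ ^ ((m + 1) ^ 2) * (blockMatrix E (p - 1) (q - 1) (m + 1) s).det) :=
            mul_le_mul g2 i1 (mul_nonneg hA0.le d0') (by positivity)
          _ = (θ ^ (m + 2) * θ ^ ((m + 1) ^ 2)) * (gapWeight p q (m + 1) (w (m + 2)) s *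
              (blockMatrix E (p - 1) (q - 1) (m + 1) s).det) := by ring
          _ ≤ _ := mul_le_mul_of_nonneg_right hexp (mul_nonneg g0 d0)
      · calc _ ≤ (θ ^ (m + 2) * P) * (θ ^ ((m + 1) ^ 2) * (scaleFactor a (p - 1) (q - 1) m *
              (blockMatrix E' (p - 1) (q - 1) (m + 1) s).det)) :=
            mul_le_mul g1 i2 d0 (by positivity)
          _ = (θ ^ (m + 2) * θ ^ ((m + 1) ^ 2)) * (P * scaleFactor a (p - 1) (q - 1) m *
              (blockMatrix E' (p - 1) (q - 1) (m + 1) s).det) := by ring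
          _ ≤ _ := mul_le_mul_of_nonneg_right hexp
            (mul_nonneg (mul_nonneg hP0.le hA0.le) d0')
    rw [hsf, ← integral_const_mul, ← integral_const_mul, ← integral_const_mul]
    exact ⟨integral_mono_ae (hi'.const_mul _) (hi.const_mul _) (key.mono fun _ h => h.1),
      integral_mono_ae hi ((hi'.const_mul _).const_mul _) (key.mono fun _ h => h.2)⟩

/-! ### Upper bound for the normalized polynomial determinant -/

lemma exists_large_gap {m : ℕ} (t : Fin (m + 2) → ℝ) :
    ∃ r : Fin (m + 1), t (Fin.last (m + 1)) - t 0 ≤ (m + 1) * (t r.succ - t r.castSucc) := by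
  have hsum : ∑ r : Fin (m + 1), (t r.succ - t r.castSucc) = t (Fin.last (m + 1)) - t 0 := by
    rw [Finset.sum_sub_distrib]
    have h1 := Fin.sum_univ_succ t
    have h2 := Fin.sum_univ_castSucc t
    linarith
  obtain ⟨r, -, hr⟩ := Finset.exists_max_image Finset.univ
    (fun r : Fin (m + 1) => t r.succ - t r.castSucc) Finset.univ_nonempty
  refine ⟨r, ?_⟩
  rw [← hsum]
  refine (Finset.sum_le_card_nsmul _ _ _ hr).trans (le_of_eq ?_)
  simp

/-- The reflection of the coordinate `J` in the corresponding gap of `t`. -/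
def reflectCoord {m : ℕ} (t : Fin (m + 2) → ℝ) (J : Fin (m + 1)) (s : Fin (m + 1) → ℝ) :
    Fin (m + 1) → ℝ :=
  fun r => (if r = J then fun y => t J.castSucc + t J.succ - y else id) (s r)

lemma measurePreserving_reflectCoord {p q m : ℕ} (t : Fin (m + 2) → ℝ) {J : Fin (m + 1)}
    (hJ : ¬ DegenerateGap p q m J) :
    MeasurePreserving (reflectCoord t J) (interlacingMeasure p q m t)
      (interlacingMeasure p q m t) := by
  unfold interlacingMeasure
  refine measurePreserving_pi _ _ fun r => ?_
  split_ifs with h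
  · subst h
    unfold gapMeasure
    rw [if_neg hJ]
    have := (Measure.measurePreserving_sub_left (volume : Measure ℝ)
      (t r.castSucc + t r.succ)).restrict_preimage
      (s := Ioo (t r.castSucc) (t r.succ)) measurableSet_Ioo
    rwa [preimage_const_sub_Ioo, add_sub_cancel_right, add_sub_cancel_left] at this
  · exact MeasurePreserving.id _

/-- Two-term Chebyshev sum inequality: `(x + y)(V + W) = 2(xV + yW) - (x - y)(V - W)`. -/
lemma two_point_chebyshev {x y V W δ δ' : ℝ} (hV : 0 ≤ V) (hW : 0 ≤ W) (hx : x ≤ δ) (hy : y ≤ δ')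
    (h : 0 ≤ (x - y) * (V - W)) : (x + y) * (V + W) ≤ 2 * (δ * V + δ' * W) := by
  nlinarith [mul_le_mul_of_nonneg_right hx hV, mul_le_mul_of_nonneg_right hy hW]

/-- The normalized determinant of the family `E` is at most a constant divided by the distance of
the extreme nodes. -/
lemma blockMatrix_det_mul_length_le {E E' : ℕ → ℕ → ℝ → ℝ}
    (hE : IsIntegralFamily (fun _ _ => 1) E) (hE' : IsIntegralFamily (fun _ _ => 1) E')
    (h1 : Monotone (E 1 1))
    (hb : ∀ c d, c ≤ d → (d - c) * (E 1 1 d - E 1 1 c) ≤ E' 1 1 d - E' 1 1 c)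
    {m : ℕ} :
    ∀ {p q : ℕ}, p ≤ m + 1 → q ≤ m + 1 → ∀ {t : Fin (m + 2) → ℝ}, IsNodes p q (m + 1) t →
      (t (Fin.last (m + 1)) - t 0) * (blockMatrix E p q (m + 1) t).det ≤
        2 ^ m * (m + 1).factorial * (blockMatrix E' p q (m + 1) t).det := by
  induction m with
  | zero =>
    intro p q hp hq t ht
    rw [blockMatrix_det_one hE hp hq, blockMatrix_det_one hE' hp hq]
    simpa using hb _ _ (ht.monotone (Fin.zero_le (Fin.last 1)))
  | succ m ih =>
    intro p q hp hq t ht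
    obtain ⟨hi, he⟩ := blockMatrix_det_succ hE (Nat.le_add_left 1 m) hq ht
    obtain ⟨hi', he'⟩ := blockMatrix_det_succ hE' (Nat.le_add_left 1 m) hq ht
    simp only [gapWeight_one, one_mul] at hi he hi' he'
    have hV0 := blockMatrix_det_nonneg hE (fun _ _ => zero_le_one) h1 (by omega) hp hq ht
    -- The induction hypothesis is weak where the interlacing vector is short. Averaging over `s`
    -- and its reflection in the largest gap `J` repairs this: the two lengths add up to at least
    -- `g`, and `V` is larger on the longer vector.
    obtain ⟨J, hJ⟩ := exists_large_gap t
    set g := t J.succ - t J.castSucc with hg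
    have hδ := ht.first_lt_last (by omega) hp hq
    have hg0 : 0 < g := by
      have : 0 < ((m + 1 : ℕ) + 1 : ℝ) * g := (sub_pos.2 hδ).trans_le hJ
      exact pos_of_mul_pos_right this (by positivity)
    have hJd : ¬ DegenerateGap p q (m + 1) J := by
      rintro (h | h)
      · rw [hg, ht.zero J.succ (by simpa using h), ht.zero J.castSucc (by simp; omega)] at hg0
        simp at hg0
      · rw [hg, ht.one J.succ (by simp; omega), ht.one J.castSucc (by simp; omega)] at hg0
        simp at hg0
    have hR := measurePreserving_reflectCoord t hJd
    set R := reflectCoord t J with hRdef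
    set C : ℝ := 2 ^ m * (m + 1).factorial with hC
    let V : (Fin (m + 2) → ℝ) → ℝ := fun s => (blockMatrix E (p - 1) (q - 1) (m + 1) s).det
    let U : (Fin (m + 2) → ℝ) → ℝ := fun s => (blockMatrix E' (p - 1) (q - 1) (m + 1) s).det
    have hae := ae_interlacing ht
    have haeR := hR.quasiMeasurePreserving.ae hae
    have hRJ : ∀ s, R s J = t J.castSucc + t J.succ - s J := fun s => by
      simp [hRdef, reflectCoord]
    have hRr : ∀ s r, r ≠ J → R s r = s r := fun s r hr => by
      simp [hRdef, reflectCoord, hr]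
    have key : ∀ᵐ s ∂interlacingMeasure p q (m + 1) t,
        g * (V s + V (R s)) ≤ 2 * C * (U s + U (R s)) := by
      filter_upwards [hae, haeR] with s hs hRs
      have hp' : p - 1 ≤ m + 1 := by omega
      have hq' : q - 1 ≤ m + 1 := by omega
      have i1 := ih hp' hq' hs.1
      have i2 := ih hp' hq' hRs.1
      have v1 := blockMatrix_det_nonneg hE (fun _ _ => zero_le_one) h1 (by omega) hp' hq' hs.1
      have v2 := blockMatrix_det_nonneg hE (fun _ _ => zero_le_one) h1 (by omega) hp' hq' hRs.1
      suffices h : g * (V s + V (R s)) ≤ 2 * ((s (Fin.last (m + 1)) - s 0) * V s +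
          (R s (Fin.last (m + 1)) - R s 0) * V (R s)) by
        have e : 2 * C * (U s + U (R s)) = 2 * (C * U s + C * U (R s)) := by ring
        rw [e]
        exact h.trans (by linarith)
      have hne : (0 : Fin (m + 2)) ≠ Fin.last (m + 1) := by
        intro h; have := congrArg Fin.val h; simp at this
      have hmono : ∀ u v : Fin (m + 2) → ℝ, IsNodes (p - 1) (q - 1) (m + 1) u →
          IsNodes (p - 1) (q - 1) (m + 1) v → v 0 ≤ u 0 →
          u (Fin.last (m + 1)) ≤ v (Fin.last (m + 1)) →
          (∀ r, r ≠ 0 → r ≠ Fin.last (m + 1) → u r = v r) → V u ≤ V v :=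
        fun u v hu hv a b c => blockMatrix_det_mono hE (fun _ _ => zero_le_one) h1 (by omega)
          hp' hq' hu hv a b c
      -- In the first gap, `s 0` and its mirror image have distances to the right end of the gap
      -- that sum to `g`. The nodes after `0` do not move, so `blockMatrix_det_mono` orders the two
      -- values of `V` oppositely to the first nodes.
      by_cases hJ0 : J = 0
      · have hother : ∀ r, r ≠ 0 → R s r = s r := fun r hr => hRr s r (by rwa [hJ0])
        have hl := hother _ hne.symm
        have hsum : R s 0 = t J.castSucc + t J.succ - s 0 := by
          simpa only [hJ0] using hRJ s
        have hlast : t J.succ ≤ s (Fin.last (m + 1)) := by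
          refine le_trans (ht.monotone ?_) (hs.2 _).1
          rw [hJ0, Fin.le_def]; simp
        have e : g = (t J.succ - s 0) + (t J.succ - R s 0) := by rw [hsum]; ring
        rw [e]
        refine two_point_chebyshev v1 v2 (by linarith) (by linarith) ?_
        rcases le_total (s 0) (R s 0) with hle | hle
        · exact mul_nonneg (by linarith) (sub_nonneg.2
            (hmono _ _ hRs.1 hs.1 hle hl.le fun r hr _ => hother r hr))
        · exact mul_nonneg_of_nonpos_of_nonpos (by linarith) (sub_nonpos.2
            (hmono _ _ hs.1 hRs.1 hle hl.ge fun r hr _ => (hother r hr).symm))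
      by_cases hJ1 : J = Fin.last (m + 1)
      · have hother : ∀ r, r ≠ Fin.last (m + 1) → R s r = s r := fun r hr =>
          hRr s r (by rwa [hJ1])
        have hl := hother _ hne
        have hsum : R s (Fin.last (m + 1)) =
            t J.castSucc + t J.succ - s (Fin.last (m + 1)) := by
          simpa only [hJ1] using hRJ s
        have hfirst : s 0 ≤ t J.castSucc := by
          refine (hs.2 0).2.trans (ht.monotone ?_)
          rw [hJ1, Fin.le_def]; simp
        have e : g = (s (Fin.last (m + 1)) - t J.castSucc) +
            (R s (Fin.last (m + 1)) - t J.castSucc) := by rw [hsum]; ring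
        rw [e]
        refine two_point_chebyshev v1 v2 (by linarith) (by linarith) ?_
        rcases le_total (s (Fin.last (m + 1))) (R s (Fin.last (m + 1))) with hle | hle
        · exact mul_nonneg_of_nonpos_of_nonpos (by linarith) (sub_nonpos.2
            (hmono _ _ hs.1 hRs.1 hl.le hle fun r _ hr => (hother r hr).symm))
        · exact mul_nonneg (by linarith) (sub_nonneg.2
            (hmono _ _ hRs.1 hs.1 hl.ge hle fun r _ hr => hother r hr))
      -- Every interlacing vector spans an interior gap, so its length is already at least `g`.
      · have hlen : ∀ u : Fin (m + 2) → ℝ,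
            (∀ r : Fin (m + 2), t r.castSucc ≤ u r ∧ u r ≤ t r.succ) →
            g ≤ u (Fin.last (m + 1)) - u 0 := by
          intro u hu
          have a : t J.succ ≤ u (Fin.last (m + 1)) := by
            refine le_trans (ht.monotone ?_) (hu _).1
            have : (J : ℕ) ≠ m + 1 := fun h => hJ1 (Fin.ext h)
            rw [Fin.le_def]; simp; omega
          have b : u 0 ≤ t J.castSucc := by
            refine (hu 0).2.trans (ht.monotone ?_)
            have : (J : ℕ) ≠ 0 := fun h => hJ0 (Fin.ext h)
            rw [Fin.le_def]; simp; omega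
          linarith
        have a := mul_le_mul_of_nonneg_right (hlen s hs.2) v1
        have b := mul_le_mul_of_nonneg_right (hlen (R s) hRs.2) v2
        have a' := mul_nonneg hg0.le v1
        have b' := mul_nonneg hg0.le v2
        simp only [V]
        linarith
    have hiR := hR.integrable_comp_of_integrable hi
    have hiR' := hR.integrable_comp_of_integrable hi'
    have hint := integral_mono_ae ((hi.add hiR).const_mul g) ((hi'.add hiR').const_mul (2 * C)) key
    have hcomp : ∀ F : (Fin (m + 2) → ℝ) → ℝ, Integrable F (interlacingMeasure p q (m + 1) t) →
        ∫ s, F (R s) ∂interlacingMeasure p q (m + 1) t =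
          ∫ s, F s ∂interlacingMeasure p q (m + 1) t := fun F hF => by
      conv_rhs => rw [← hR.map_eq]
      rw [integral_map hR.measurable.aemeasurable (by rw [hR.map_eq]; exact hF.1)]
    rw [integral_const_mul, integral_const_mul, integral_add' hi hiR,
      integral_add' hi' hiR'] at hint
    simp only [Function.comp_def] at hint
    rw [hcomp _ hi, hcomp _ hi', ← he, ← he'] at hint
    have hfac : ((m + 1 + 1).factorial : ℝ) = (m + 2) * (m + 1).factorial := by
      rw [Nat.factorial_succ (m + 1)]; push_cast; ring
    have h3 := mul_le_mul_of_nonneg_right hJ hV0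
    push_cast at h3
    -- One level costs `2` from the averaging and `m + 2` from comparing the total length with the
    -- largest gap; this produces the constant `2 ^ m * (m + 1)!`.
    calc _ ≤ (m + 1 + 1) * g * (blockMatrix E p q (m + 1 + 1) t).det := h3
      _ = (m + 2) * (g * (blockMatrix E p q (m + 1 + 1) t).det) := by ring
      _ ≤ (m + 2) * (2 * C * (blockMatrix E' p q (m + 1 + 1) t).det) :=
        mul_le_mul_of_nonneg_left (by linarith) (by positivity)
      _ = _ := by rw [hfac, hC]; ring

/-! ### Adapted and ordinary derivatives -/

/-- The functions `F 0 = f, F 1, F 2, …` are the adapted derivatives of `f` on the relatively open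
part `O` of `[0,1]`. -/
structure IsAdaptedChain (w : ℕ → ℝ → ℝ) (k : ℕ) (O : Set ℝ) (f : ℝ → ℝ) (F : ℕ → ℝ → ℝ) :
    Prop where
  isOpen : IsOpen O
  eq_zero : ∀ y ∈ Icc (0 : ℝ) 1 ∩ O, f y = F 0 y
  hasDeriv : ∀ d, d + 1 < k → ∀ y ∈ Icc (0 : ℝ) 1 ∩ O,
    HasDerivWithinAt (F d) (w (k - d) y * F (d + 1) y) (Icc 0 1) y

section Chains

variable {w : ℕ → ℝ → ℝ} {k : ℕ} {O : Set ℝ} {f : ℝ → ℝ} {F : ℕ → ℝ → ℝ}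

lemma uniqueDiffWithinAt_unit {y : ℝ} (hy : y ∈ Icc (0 : ℝ) 1) :
    UniqueDiffWithinAt ℝ (Icc (0 : ℝ) 1) y := uniqueDiffOn_Icc zero_lt_one y hy

lemma derivWithin_eq_of_eqOn {f g : ℝ → ℝ} {g' y : ℝ} (hO : IsOpen O)
    (hfg : ∀ z ∈ Icc (0 : ℝ) 1 ∩ O, f z = g z) (hy : y ∈ Icc (0 : ℝ) 1 ∩ O)
    (hg : HasDerivWithinAt g g' (Icc 0 1) y) : derivWithin f (Icc 0 1) y = g' := by
  have h : f =ᶠ[nhdsWithin y (Icc 0 1)] g := by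
    filter_upwards [self_mem_nhdsWithin, mem_nhdsWithin_of_mem_nhds (hO.mem_nhds hy.2)] with z h1 h2
    exact hfg z ⟨h1, h2⟩
  rw [h.derivWithin_eq (hfg y hy)]
  exact hg.derivWithin (uniqueDiffWithinAt_unit hy.1)

lemma IsAdaptedChain.dualDeriv_eq (hF : IsAdaptedChain w k O f F) (hw : ∀ j y, w j y ≠ 0)
    {d : ℕ} (hd : d < k) : ∀ y ∈ Icc (0 : ℝ) 1 ∩ O, dualDeriv w k d f y = F d y := by
  induction d with
  | zero => exact hF.eq_zero
  | succ d ih =>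
    intro y hy
    change derivWithin (dualDeriv w k d f) (Icc 0 1) y / w (k - d) y = _
    rw [derivWithin_eq_of_eqOn hF.isOpen (ih (by omega)) hy (hF.hasDeriv d hd y hy),
      mul_div_cancel_left₀ _ (hw _ _)]

/-- The coefficients of the expansion of ordinary derivatives in adapted ones. -/
def derivCoeff (w : ℕ → ℝ → ℝ) (k : ℕ) : ℕ → ℕ → ℝ → ℝ
  | 0, 0 => fun _ => 1
  | 0, _ + 1 => fun _ => 0
  | d + 1, 0 => derivWithin (derivCoeff w k d 0) (Icc 0 1)
  | d + 1, e + 1 => fun y => derivWithin (derivCoeff w k d (e + 1)) (Icc 0 1) y +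
      derivCoeff w k d e y * w (k - e) y

lemma derivCoeff_of_lt (w : ℕ → ℝ → ℝ) (k : ℕ) {d e : ℕ} (h : d < e) :
    derivCoeff w k d e = fun _ => 0 := by
  induction d generalizing e with
  | zero =>
    obtain ⟨e, rfl⟩ : ∃ n, e = n + 1 := ⟨e - 1, by omega⟩
    rfl
  | succ d ih =>
    obtain ⟨e, rfl⟩ : ∃ n, e = n + 1 := ⟨e - 1, by omega⟩
    ext y
    simp [derivCoeff, ih (show d < e + 1 by omega), ih (show d < e by omega)]

lemma derivCoeff_self_ne_zero (hw : ∀ j y, w j y ≠ 0) (k d : ℕ) (y : ℝ) :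
    derivCoeff w k d d y ≠ 0 := by
  induction d with
  | zero => exact one_ne_zero
  | succ d ih =>
    simp only [derivCoeff, derivCoeff_of_lt w k (Nat.lt_succ_self d)]
    simpa using ⟨ih, hw _ _⟩

/-- Each differentiation costs one order. The new factor in the coefficient `(d + 1, e + 1)` is `w
(k - e)`, relevant only for `e ≤ d`, and it must be `C^{k-2-d}`. Since `k - e - 2 ≥ k - 2 - d`, the
condition `w_j ∈ C^{j-2}` is enough. -/
lemma contDiffOn_derivCoeff
    (hsm : ∀ j ∈ Finset.Icc 1 k, ContDiffOn ℝ ((j - 2 : ℕ) : WithTop ℕ∞) (w j) (Icc 0 1))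
    {d : ℕ} (hd : d < k) (e : ℕ) :
    ContDiffOn ℝ ((k - 1 - d : ℕ) : WithTop ℕ∞) (derivCoeff w k d e) (Icc 0 1) := by
  induction d generalizing e with
  | zero => cases e <;> exact contDiffOn_const
  | succ d ih =>
    have hder : ∀ e, ContDiffOn ℝ ((k - 1 - (d + 1) : ℕ) : WithTop ℕ∞)
        (derivWithin (derivCoeff w k d e) (Icc 0 1)) (Icc 0 1) := fun e => by
      refine (ih (by omega) e).derivWithin (uniqueDiffOn_Icc zero_lt_one) ?_
      exact_mod_cast (show k - 1 - (d + 1) + 1 ≤ k - 1 - d by omega)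
    cases e with
    | zero => exact hder 0
    | succ e =>
      refine (hder (e + 1)).add ?_
      rcases lt_or_ge d e with h | h
      · simp only [derivCoeff_of_lt w k h, zero_mul]
        exact contDiffOn_const
      · refine ((ih (by omega) e).of_le ?_).mul ((hsm (k - e) ?_).of_le ?_)
        · exact_mod_cast (show k - 1 - (d + 1) ≤ k - 1 - d by omega)
        · rw [Finset.mem_Icc]; omega
        · exact_mod_cast (show k - 1 - (d + 1) ≤ k - e - 2 by omega)

lemma IsAdaptedChain.ordDeriv_eq (hF : IsAdaptedChain w k O f F)
    (hsm : ∀ j ∈ Finset.Icc 1 k, ContDiffOn ℝ ((j - 2 : ℕ) : WithTop ℕ∞) (w j) (Icc 0 1))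
    {d : ℕ} (hd : d < k) : ∀ y ∈ Icc (0 : ℝ) 1 ∩ O,
      ordDeriv d f y = ∑ e ∈ Finset.range (d + 1), derivCoeff w k d e y * F e y := by
  induction d with
  | zero =>
    intro y hy
    simp [ordDeriv, derivCoeff, hF.eq_zero y hy]
  | succ d ih =>
    intro y hy
    have hc : ∀ e, HasDerivWithinAt (derivCoeff w k d e)
        (derivWithin (derivCoeff w k d e) (Icc 0 1) y) (Icc 0 1) y := fun e => by
      have h := (contDiffOn_derivCoeff hsm (show d < k by omega) e).differentiableOn
        (by exact_mod_cast (show k - 1 - d ≠ 0 by omega))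
      exact (h y hy.1).hasDerivWithinAt
    have hsum : HasDerivWithinAt
        (fun z => ∑ e ∈ Finset.range (d + 1), derivCoeff w k d e z * F e z)
        (∑ e ∈ Finset.range (d + 1), (derivWithin (derivCoeff w k d e) (Icc 0 1) y * F e y +
          derivCoeff w k d e y * (w (k - e) y * F (e + 1) y))) (Icc 0 1) y :=
      HasDerivWithinAt.fun_sum fun e he =>
        (hc e).mul (hF.hasDeriv e (by have := Finset.mem_range.1 he; omega) y hy)
    have h1 : ordDeriv (d + 1) f y = derivWithin (ordDeriv d f) (Icc 0 1) y :=
      congrFun iteratedDerivWithin_succ y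
    rw [h1, derivWithin_eq_of_eqOn hF.isOpen (ih (by omega)) hy hsum, Finset.sum_add_distrib,
      Finset.sum_range_succ' (fun e => derivCoeff w k (d + 1) e y * F e y)]
    have h2 : ∑ e ∈ Finset.range (d + 1), derivWithin (derivCoeff w k d e) (Icc 0 1) y * F e y =
        ∑ e ∈ Finset.range (d + 1 + 1), derivWithin (derivCoeff w k d e) (Icc 0 1) y * F e y := by
      rw [Finset.sum_range_succ _ (d + 1), derivCoeff_of_lt w k (Nat.lt_succ_self d)]
      simp
    rw [h2, Finset.sum_range_succ' _ (d + 1), add_right_comm, ← Finset.sum_add_distrib]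
    refine congrArg₂ _ (Finset.sum_congr rfl fun e _ => ?_) rfl
    simp only [derivCoeff]
    ring

end Chains

section RepIndex

variable {m : ℕ} (s : Fin m → ℝ)

/-- Over the indices up to `i` with the same node, `repIndex` takes each value `0, …, repIndex s i`
exactly once; so a row combination is a sum over derivative orders. -/
lemma sum_repIndex (i : Fin m) (g : ℕ → ℝ) :
    ∑ i' : Fin m, (if i' ≤ i ∧ s i' = s i then g (repIndex s i') else 0) =
      ∑ e ∈ Finset.range (repIndex s i + 1), g e := by
  classical
  rw [← Finset.sum_filter]
  set S : Finset (Fin m) := Finset.univ.filter fun i' => i' ≤ i ∧ s i' = s i with hS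
  have hlt : ∀ a ∈ S, ∀ b ∈ S, a < b → repIndex s a < repIndex s b := by
    intro a ha b hb hab
    simp only [hS, Finset.mem_filter, Finset.mem_univ, true_and] at ha hb
    unfold repIndex
    refine Finset.card_lt_card ⟨fun c hc => ?_, fun h => ?_⟩
    · simp only [Finset.mem_filter, Finset.mem_univ, true_and] at hc ⊢
      exact ⟨hc.1.trans hab, by rw [hc.2, ha.2, hb.2]⟩
    · have : a ∈ Finset.univ.filter fun j => j < b ∧ s j = s b := by
        simp [hab, ha.2, hb.2]
      have := h this
      simp at this
  have hiS : i ∈ S := by simp [hS]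
  have hinj : Set.InjOn (repIndex s) S := by
    intro a ha b hb hab
    rcases lt_trichotomy a b with h | h | h
    · exact absurd hab (hlt a ha b hb h).ne
    · exact h
    · exact absurd hab (hlt b hb a ha h).ne'
  have hcard : S.card = repIndex s i + 1 := by
    have : S = insert i (Finset.univ.filter fun j => j < i ∧ s j = s i) := by
      ext j
      simp only [hS, Finset.mem_filter, Finset.mem_univ, true_and, Finset.mem_insert]
      constructor
      · rintro ⟨h1, h2⟩
        rcases h1.eq_or_lt with h | h
        · exact Or.inl h
        · exact Or.inr ⟨h, h2⟩
      · rintro (rfl | ⟨h1, h2⟩)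
        · exact ⟨le_rfl, rfl⟩
        · exact ⟨h1.le, h2⟩
    rw [this, Finset.card_insert_of_notMem (by simp), repIndex]
  have himg : S.image (repIndex s) = Finset.range (repIndex s i + 1) := by
    refine Finset.eq_of_subset_of_card_le (fun e he => ?_) ?_
    · obtain ⟨a, ha, rfl⟩ := Finset.mem_image.1 he
      have hai : a ≤ i := by
        simp only [hS, Finset.mem_filter, Finset.mem_univ, true_and] at ha; exact ha.1
      rw [Finset.mem_range, Nat.lt_succ_iff]
      rcases hai.eq_or_lt with h | h
      · rw [h]
      · exact (hlt a ha i hiS h).le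
    · rw [Finset.card_image_of_injOn hinj, hcard, Finset.card_range]
  rw [← himg, Finset.sum_image hinj]

/-- The triangular matrix that transforms adapted into ordinary derivatives. -/
def transitionMatrix (w : ℕ → ℝ → ℝ) (k : ℕ) : Matrix (Fin m) (Fin m) ℝ :=
  Matrix.of fun i i' => if i' ≤ i ∧ s i' = s i then
    derivCoeff w k (repIndex s i) (repIndex s i') (s i) else 0

lemma transitionMatrix_det_ne_zero {w : ℕ → ℝ → ℝ} (hw : ∀ j y, w j y ≠ 0) (k : ℕ) :
    (transitionMatrix s w k).det ≠ 0 := by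
  rw [Matrix.det_of_isLowerTriangular]
  · refine Finset.prod_ne_zero_iff.2 fun i _ => ?_
    simpa [transitionMatrix] using derivCoeff_self_ne_zero hw k _ _
  · intro i j hij
    have : i < j := hij
    simp [transitionMatrix, this.not_ge]

/-- The expansion coefficients are the same for all columns, so they form a left factor. Membership
in `O` is required only at nodes where a derivative is taken. -/
lemma confluentDet_ordDeriv {w : ℕ → ℝ → ℝ} (hw : ∀ j y, w j y ≠ 0) {k : ℕ}
    (hsm : ∀ j ∈ Finset.Icc 1 k, ContDiffOn ℝ ((j - 2 : ℕ) : WithTop ℕ∞) (w j) (Icc 0 1))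
    (hs : ∀ i, s i ∈ Icc (0 : ℝ) 1) (hk : ∀ i, repIndex s i < k) (u : Fin m → ℝ → ℝ)
    (hu : ∀ j, ∃ O F, IsAdaptedChain w k O (u j) F ∧ ∀ i, repIndex s i = 0 ∨ s i ∈ O) :
    confluentDet ordDeriv s u =
      (transitionMatrix s w k).det * confluentDet (dualDeriv w k) s u := by
  unfold confluentDet
  rw [← Matrix.det_mul]
  congr 1
  ext i j
  simp only [Matrix.mul_apply, Matrix.of_apply, transitionMatrix]
  have h1 : ∀ i' : Fin m, (if i' ≤ i ∧ s i' = s i then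
      derivCoeff w k (repIndex s i) (repIndex s i') (s i) else 0) *
        dualDeriv w k (repIndex s i') (u j) (s i') =
      if i' ≤ i ∧ s i' = s i then derivCoeff w k (repIndex s i) (repIndex s i') (s i) *
        dualDeriv w k (repIndex s i') (u j) (s i) else 0 := by
    intro i'
    split_ifs with h
    · rw [h.2]
    · simp
  simp_rw [h1]
  rw [sum_repIndex s i fun e => derivCoeff w k (repIndex s i) e (s i) *
    dualDeriv w k e (u j) (s i)]
  obtain ⟨O, F, hF, hO⟩ := hu j
  rcases hO i with h | h
  · simp [h, ordDeriv, dualDeriv, derivCoeff]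
  · rw [hF.ordDeriv_eq hsm (hk i) _ ⟨hs i, h⟩]
    refine Finset.sum_congr rfl fun e he => ?_
    rw [hF.dualDeriv_eq hw (by have := Finset.mem_range.1 he; have := hk i; omega) _ ⟨hs i, h⟩]

end RepIndex

/-! ### The two families and their determinants -/

/-- The dual functions, indexed by the order of the spline and the column. -/
def dualFamily (w : ℕ → ℝ → ℝ) (m j : ℕ) : ℝ → ℝ := dualFun w m (j + 1)

/-- The dual functions with the last column replaced by `(-1)^m g_m(x, ·)`. -/
def kernelFamily (w : ℕ → ℝ → ℝ) (x : ℝ) (m j : ℕ) (y : ℝ) : ℝ :=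
  if j < m then dualFun w m (j + 1) y else (-1) ^ m * gFun w m x y

section Families

variable {w : ℕ → ℝ → ℝ}

lemma dualFun_sub (hw : ∀ j, Continuous (w j)) (m j : ℕ) (a b : ℝ) :
    dualFun w (m + 1) (j + 2) b - dualFun w (m + 1) (j + 2) a =
      ∫ s in a..b, w (m + 1) s * dualFun w m (j + 1) s := by
  have hc : Continuous fun s => w (m + 1) s * dualFun w m (j + 1) s :=
    (hw _).mul (continuous_dualFun hw _ _)
  rw [dualFun_succ, dualFun_succ, intervalIntegral.integral_interval_sub_left
    (hc.intervalIntegrable _ _) (hc.intervalIntegrable _ _)]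

lemma isIntegralFamily_dualFamily (hw : ∀ j, Continuous (w j)) :
    IsIntegralFamily w (dualFamily w) where
  zero m y _ := by simp [dualFamily, dualFun_one]
  sub m j a b _ _ _ := dualFun_sub hw m j a b
  integrable m j a b := ((hw _).mul (continuous_dualFun hw _ _)).intervalIntegrable _ _

/-- The factor `(-1) ^ m` absorbs the sign that arises in each differentiation in the lower limit.
-/
lemma isIntegralFamily_kernelFamily (hw : ∀ j, Continuous (w j)) (x : ℝ) :
    IsIntegralFamily w (kernelFamily w x) where
  zero m y hm := by simp [kernelFamily, dualFun_one, show 0 < m by omega]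
  sub m j a b hm hj hab := by
    rcases hj.lt_or_eq with h | rfl
    · simp only [kernelFamily, h, add_lt_add_iff_right, if_true]
      exact dualFun_sub hw m j a b
    · simp only [kernelFamily, lt_irrefl, if_false]
      rw [← mul_sub, gFun_sub hw hm x hab, pow_succ]
      rw [show ∀ I : ℝ, (-1 : ℝ) ^ j * -1 * -I = (-1) ^ j * I from fun I => by ring,
        ← intervalIntegral.integral_const_mul]
      refine intervalIntegral.integral_congr fun s _ => ?_
      ring
  integrable m j a b := by
    unfold kernelFamily
    split_ifs
    · exact ((hw _).mul (continuous_dualFun hw _ _)).intervalIntegrable _ _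
    · have := (intervalIntegrable_mul_gFun hw (m + 1) m x a b).const_mul ((-1) ^ m)
      refine this.congr fun s _ => ?_
      ring

lemma dualFamily_one_one_sub (hw : ∀ j, Continuous (w j)) (a b : ℝ) :
    dualFamily w 1 1 b - dualFamily w 1 1 a = ∫ s in a..b, w 1 s := by
  simpa [dualFamily, dualFun_one] using dualFun_sub hw 0 0 a b

/-- A nondecreasing step of height `w 1 x` at `x`: in the recursion this family starts from a point
mass at `x`, where `dualFamily` starts from the density `w 1`. -/
lemma kernelFamily_one_one (x y : ℝ) :
    kernelFamily w x 1 1 y = if y ≤ x then -w 1 x else 0 := by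
  simp only [kernelFamily, lt_irrefl, if_false, gFun, hFun_one]
  split_ifs <;> simp

lemma monotone_dualFamily (hw : ∀ j, Continuous (w j)) (h0 : ∀ j y, 0 ≤ w j y) :
    Monotone (dualFamily w 1 1) := fun a b hab => by
  rw [← sub_nonneg, dualFamily_one_one_sub hw]
  exact intervalIntegral.integral_nonneg hab fun _ _ => h0 _ _

lemma monotone_kernelFamily (h0 : ∀ j y, 0 ≤ w j y) (x : ℝ) :
    Monotone (kernelFamily w x 1 1) := fun a b hab => by
  rw [kernelFamily_one_one, kernelFamily_one_one]
  have := h0 1 x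
  split_ifs <;> linarith

lemma dualFamily_det_pos (hw : ∀ j, Continuous (w j)) (h0 : ∀ j y, 0 < w j y) {m p q : ℕ}
    (hm : 1 ≤ m) (hp : p ≤ m) (hq : q ≤ m) {t : Fin (m + 1) → ℝ} (ht : IsNodes p q m t) :
    0 < (blockMatrix (dualFamily w) p q m t).det := by
  have hlt := ht.first_lt_last hm hp hq
  refine blockMatrix_det_pos (isIntegralFamily_dualFamily hw) h0
    (monotone_dualFamily hw fun j y => (h0 j y).le) (x := (t 0 + t (Fin.last m)) / 2)
    (fun a b ha hb => ?_) hm hp hq ht (by linarith) (by linarith)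
  rw [← sub_pos, dualFamily_one_one_sub hw]
  exact intervalIntegral.intervalIntegral_pos_of_pos ((hw 1).intervalIntegrable _ _) (h0 1)
    (ha.trans hb)

lemma kernelFamily_det_pos (hw : ∀ j, Continuous (w j)) (h0 : ∀ j y, 0 < w j y) {m p q : ℕ}
    (hm : 1 ≤ m) (hp : p ≤ m) (hq : q ≤ m) {t : Fin (m + 1) → ℝ} (ht : IsNodes p q m t) {x : ℝ}
    (hx0 : t 0 < x) (hx1 : x < t (Fin.last m)) :
    0 < (blockMatrix (kernelFamily w x) p q m t).det := by
  refine blockMatrix_det_pos (isIntegralFamily_kernelFamily hw x) h0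
    (monotone_kernelFamily (fun j y => (h0 j y).le) x) (x := x)
    (fun a b ha hb => ?_) hm hp hq ht hx0 hx1
  rw [kernelFamily_one_one, kernelFamily_one_one, if_pos ha.le, if_neg hb.not_ge]
  linarith [h0 1 x]

lemma blockMatrix_det_eq_zero {E : ℕ → ℕ → ℝ → ℝ} (hE : IsIntegralFamily w E) {α β : ℝ}
    (h : ∀ c ∈ Icc α β, ∀ d ∈ Icc α β, E 1 1 c = E 1 1 d) {m : ℕ} (hm : 1 ≤ m) :
    ∀ {p q : ℕ}, p ≤ m → q ≤ m → ∀ {t : Fin (m + 1) → ℝ}, IsNodes p q m t →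
      (∀ r, t r ∈ Icc α β) → (blockMatrix E p q m t).det = 0 := by
  induction m, hm using Nat.le_induction with
  | base =>
    intro p q hp hq t ht htI
    rw [blockMatrix_det_one hE hp hq, h _ (htI 1) _ (htI 0), sub_self]
  | succ m hm ih =>
    intro p q hp hq t ht htI
    rw [(blockMatrix_det_succ hE hm hq ht).2]
    refine integral_eq_zero_of_ae ?_
    filter_upwards [ae_interlacing ht] with s hs
    simp [ih (by omega) (by omega) hs.1 fun r =>
      ⟨(htI _).1.trans (hs.2 r).1, (hs.2 r).2.trans (htI _).2⟩]

lemma kernelFamily_det_eq_zero (hw : ∀ j, Continuous (w j)) {m p q : ℕ}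
    (hm : 1 ≤ m) (hp : p ≤ m) (hq : q ≤ m) {t : Fin (m + 1) → ℝ} (ht : IsNodes p q m t) {x : ℝ}
    (hx : x ∉ Icc (t 0) (t (Fin.last m))) :
    (blockMatrix (kernelFamily w x) p q m t).det = 0 := by
  refine blockMatrix_det_eq_zero (isIntegralFamily_kernelFamily hw x) (α := t 0)
    (β := t (Fin.last m)) (fun c hc d hd => ?_) hm hp hq ht
    fun r => ⟨ht.monotone (Fin.zero_le r), ht.monotone (Fin.le_last r)⟩
  rw [kernelFamily_one_one, kernelFamily_one_one]
  rw [mem_Icc, not_and_or, not_le, not_le] at hx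
  rcases hx with h | h
  · rw [if_neg (h.trans_le hc.1).not_ge, if_neg (h.trans_le hd.1).not_ge]
  · rw [if_pos (hc.2.trans h.le), if_pos (hd.2.trans h.le)]

/-- Comparison with the determinants for the weights `1`. -/
lemma family_det_compare (hw : ∀ j, Continuous (w j)) (h0 : ∀ j y, 0 ≤ w j y) {a : ℕ → ℝ}
    {θ : ℝ} (hθ : 1 ≤ θ) (ha : ∀ j, 0 < a j) {m p q : ℕ} (hp : p ≤ m + 1) (hq : q ≤ m + 1)
    {t : Fin (m + 2) → ℝ} (ht : IsNodes p q (m + 1) t)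
    (hle : ∀ j, 1 ≤ j → j ≤ m + 1 → ∀ y ∈ Icc (t 0) (t (Fin.last (m + 1))), w j y ≤ θ * a j)
    (hge : ∀ j, 1 ≤ j → j ≤ m + 1 → ∀ y ∈ Icc (t 0) (t (Fin.last (m + 1))), a j ≤ θ * w j y) (x : ℝ) :
    ((scaleFactor a p q m * (blockMatrix (dualFamily fun _ _ => 1) p q (m + 1) t).det ≤
        θ ^ ((m + 1) ^ 2) * (blockMatrix (dualFamily w) p q (m + 1) t).det) ∧
      (blockMatrix (dualFamily w) p q (m + 1) t).det ≤ θ ^ ((m + 1) ^ 2) *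
        (scaleFactor a p q m * (blockMatrix (dualFamily fun _ _ => 1) p q (m + 1) t).det)) ∧
    ((scaleFactor a p q m * (blockMatrix (kernelFamily (fun _ _ => 1) x) p q (m + 1) t).det ≤
        θ ^ ((m + 1) ^ 2) * (blockMatrix (kernelFamily w x) p q (m + 1) t).det) ∧
      (blockMatrix (kernelFamily w x) p q (m + 1) t).det ≤ θ ^ ((m + 1) ^ 2) *
        (scaleFactor a p q m *
          (blockMatrix (kernelFamily (fun _ _ => 1) x) p q (m + 1) t).det)) := by
  have hc1 : ∀ j : ℕ, Continuous ((fun _ _ => 1 : ℕ → ℝ → ℝ) j) := fun _ => continuous_const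
  have h01 : ∀ (j : ℕ) (y : ℝ), 0 ≤ (fun _ _ => 1 : ℕ → ℝ → ℝ) j y := fun _ _ => zero_le_one
  have htI : ∀ r, t r ∈ Icc (t 0) (t (Fin.last (m + 1))) := fun r =>
    ⟨ht.monotone (Fin.zero_le r), ht.monotone (Fin.le_last r)⟩
  constructor
  · refine blockMatrix_det_compare (isIntegralFamily_dualFamily hw)
      (isIntegralFamily_dualFamily hc1) h0 (monotone_dualFamily hw h0)
      (monotone_dualFamily hc1 h01) hθ ha hle hge (fun c hc d hd hcd => ?_) le_rfl hp hq ht htI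
    have hsub : ∀ y ∈ Icc c d, y ∈ Icc (t 0) (t (Fin.last (m + 1))) := fun y hy =>
      ⟨hc.1.trans hy.1, hy.2.trans hd.2⟩
    rw [dualFamily_one_one_sub hw, dualFamily_one_one_sub hc1,
      ← intervalIntegral.integral_const_mul, ← intervalIntegral.integral_const_mul,
      ← intervalIntegral.integral_const_mul]
    refine ⟨intervalIntegral.integral_mono_on hcd (Continuous.intervalIntegrable (by fun_prop) _ _)
      (((hw 1).const_mul θ).intervalIntegrable _ _) fun y hy => ?_,
      intervalIntegral.integral_mono_on hcd ((hw 1).intervalIntegrable _ _)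
      (Continuous.intervalIntegrable (by fun_prop) _ _) fun y hy => ?_⟩
    · simpa using hge 1 le_rfl (by omega) y (hsub y hy)
    · simpa using hle 1 le_rfl (by omega) y (hsub y hy)
  · refine blockMatrix_det_compare (isIntegralFamily_kernelFamily hw x)
      (isIntegralFamily_kernelFamily hc1 x) h0 (monotone_kernelFamily h0 x)
      (monotone_kernelFamily h01 x) hθ ha hle hge (fun c hc d hd hcd => ?_) le_rfl hp hq ht htI
    simp only [kernelFamily_one_one]
    rcases lt_or_ge x c with hxc | hxc
    · simp [hxc.not_ge, (hxc.trans_le hcd).not_ge]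
    rcases le_or_gt d x with hxd | hxd
    · simp [hxc, hxd]
    · have hx : x ∈ Icc (t 0) (t (Fin.last (m + 1))) := ⟨hc.1.trans hxc, hxd.le.trans hd.2⟩
      simpa [hxc, hxd.not_ge] using ⟨hge 1 le_rfl (by omega) x hx, hle 1 le_rfl (by omega) x hx⟩

lemma kernelFamily_det_mul_length_le (x : ℝ) {m p q : ℕ} (hp : p ≤ m + 1) (hq : q ≤ m + 1)
    {t : Fin (m + 2) → ℝ} (ht : IsNodes p q (m + 1) t) :
    (t (Fin.last (m + 1)) - t 0) *
        (blockMatrix (kernelFamily (fun _ _ => 1) x) p q (m + 1) t).det ≤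
      2 ^ m * (m + 1).factorial * (blockMatrix (dualFamily fun _ _ => 1) p q (m + 1) t).det := by
  have hc1 : ∀ j : ℕ, Continuous ((fun _ _ => 1 : ℕ → ℝ → ℝ) j) := fun _ => continuous_const
  refine blockMatrix_det_mul_length_le (isIntegralFamily_kernelFamily hc1 x)
    (isIntegralFamily_dualFamily hc1) (monotone_kernelFamily (fun _ _ => zero_le_one) x)
    (fun c d hcd => ?_) hp hq ht
  rw [dualFamily_one_one_sub hc1, kernelFamily_one_one, kernelFamily_one_one]
  simp only [intervalIntegral.integral_const, smul_eq_mul, mul_one]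
  split_ifs <;> simp <;> linarith

end Families

/-! ### The defining determinants as block determinants -/

section AdaptedDerivatives

variable {w : ℕ → ℝ → ℝ}

lemma isAdaptedChain_dualFun (hw : ∀ j, Continuous (w j)) (k j : ℕ) :
    IsAdaptedChain w k univ (dualFun w k (j + 1))
      (fun d y => if d ≤ j then dualFun w (k - d) (j - d + 1) y else 0) where
  isOpen := isOpen_univ
  eq_zero y _ := by simp
  hasDeriv d hd y _ := by
    rcases lt_trichotomy d j with h | rfl | h
    · have := hasDerivAt_dualFun hw (k - (d + 1)) (j - (d + 1)) y
      rw [show k - (d + 1) + 1 = k - d by omega,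
        show j - (d + 1) + 2 = j - d + 1 by omega] at this
      simp only [h.le, Nat.succ_le_of_lt h, if_true]
      exact this.hasDerivWithinAt
    · simp [dualFun_one, hasDerivWithinAt_const]
    · simp [h.not_ge, show ¬ d + 1 ≤ j by omega, hasDerivWithinAt_const]

/-- The truncation can create a corner at `y = x`, except for `x = 1`, where all of `[0,1]` lies on
one side. -/
lemma hasDerivWithinAt_gFun (hw : ∀ j, Continuous (w j)) {m : ℕ} (hm : 1 ≤ m) {x y : ℝ}
    (hy : y ∈ Icc (0 : ℝ) 1) (hxy : y ≠ x ∨ x = 1) :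
    HasDerivWithinAt (gFun w (m + 1) x) (-(w (m + 1) y * gFun w m x y)) (Icc 0 1) y := by
  have hIic : y ≤ x → Iic x ∈ nhdsWithin y (Icc 0 1) → HasDerivWithinAt (gFun w (m + 1) x)
      (-(w (m + 1) y * gFun w m x y)) (Icc 0 1) y := by
    intro hyx hnhds
    have h1 := hasDerivWithinAt_hFun hw hm (x := x) (y := y) (s := Iic x) (fun z hz => hz) hyx
    have h2 := h1.congr (f₁ := gFun w (m + 1) x)
      (fun z hz => by rw [gFun, if_pos (mem_Iic.1 hz)]) (by rw [gFun, if_pos hyx])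
    rw [gFun, if_pos hyx]
    exact h2.mono_of_mem_nhdsWithin hnhds
  rcases lt_trichotomy y x with h | rfl | h
  · exact hIic h.le (mem_nhdsWithin_of_mem_nhds (Iic_mem_nhds h))
  · obtain rfl : y = 1 := hxy.resolve_left (by simp)
    exact hIic le_rfl (Filter.mem_of_superset self_mem_nhdsWithin fun z hz => hz.2)
  · have : gFun w m x y = 0 := if_neg h.not_ge
    rw [this, mul_zero, neg_zero]
    refine (hasDerivWithinAt_const y (Icc (0 : ℝ) 1) (0 : ℝ)).congr_of_eventuallyEq ?_
      (if_neg h.not_ge)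
    filter_upwards [mem_nhdsWithin_of_mem_nhds (Ioi_mem_nhds h)] with z hz
    exact if_neg (mem_Ioi.1 hz).not_ge

lemma isAdaptedChain_gFun (hw : ∀ j, Continuous (w j)) (k : ℕ) (x : ℝ) :
    IsAdaptedChain w k {y | y ≠ x ∨ x = 1} (gFun w k x)
      (fun d y => (-1) ^ d * gFun w (k - d) x y) where
  isOpen := by
    by_cases h : x = 1
    · simp [h]
    · simpa [h] using isOpen_ne
  eq_zero y _ := by simp
  hasDeriv d hd y hy := by
    have h := hasDerivWithinAt_gFun hw (m := k - (d + 1)) (by omega) hy.1 hy.2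
    rw [show k - (d + 1) + 1 = k - d by omega] at h
    exact (h.const_mul ((-1) ^ d)).congr_deriv (by rw [pow_succ]; ring)

/-- At `x = 0` the derivatives at the node `0` see only the zero function, whereas the recursion
would put `g_1(0, 0) = w_1(0)` into the last derivative row; hence this point is treated apart. -/
lemma gFun_zero_left {k : ℕ} (hk : 2 ≤ k) {y : ℝ} (hy : y ∈ Icc (0 : ℝ) 1) :
    gFun w k 0 y = 0 := by
  unfold gFun
  split_ifs with h
  · rw [le_antisymm h hy.1, hFun_self hk]
  · rfl

lemma isAdaptedChain_gFun_zero {k : ℕ} (hk : 2 ≤ k) :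
    IsAdaptedChain w k univ (gFun w k 0) (fun _ _ => 0) where
  isOpen := isOpen_univ
  eq_zero y hy := gFun_zero_left hk hy.1
  hasDeriv d _ y _ := by simp [hasDerivWithinAt_const]

lemma IsNodes.repIndex_eq {p q m : ℕ} {t : Fin (m + 1) → ℝ} (ht : IsNodes p q m t)
    (hq : q ≤ m) (r : Fin (m + 1)) : repIndex t r = blockIndex p q m r := by
  classical
  unfold repIndex blockIndex
  split_ifs with h1 h2
  · have : (Finset.univ.filter fun j => j < r ∧ t j = t r) = Finset.Iio r := by
      ext j
      simp only [Finset.mem_filter, Finset.mem_univ, true_and, Finset.mem_Iio,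
        and_iff_left_iff_imp]
      intro hj
      rw [ht.zero r h1, ht.zero j (lt_trans hj h1)]
    calc _ = (Finset.Iio r).card := by rw [← this]
      _ = r := Fin.card_Iio r
  · have hq' : m + 1 - q < m + 1 := by have := r.2; omega
    have : (Finset.univ.filter fun j => j < r ∧ t j = t r) =
        Finset.Ico (⟨m + 1 - q, hq'⟩ : Fin (m + 1)) r := by
      ext j
      simp only [Finset.mem_filter, Finset.mem_univ, true_and, Finset.mem_Ico, Fin.le_def]
      rw [ht.one r h2]
      constructor
      · rintro ⟨a, b⟩
        refine ⟨?_, a⟩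
        by_contra hlt
        exact (ht.lt_one j (by omega)).ne b
      · rintro ⟨a, b⟩
        exact ⟨b, ht.one j (by omega)⟩
    calc _ = (Finset.Ico (⟨m + 1 - q, hq'⟩ : Fin (m + 1)) r).card := by rw [← this]
      _ = r - (m + 1 - q) := Fin.card_Ico _ _
      _ = _ := by omega
  · rw [Finset.card_eq_zero, Finset.filter_eq_empty_iff]
    rintro j - ⟨hj, he⟩
    exact (ht.lt j r hj (by omega) (by have := Fin.lt_def.1 hj; omega)).ne he

lemma blockIndex_lt {p q m r : ℕ} (hm : 1 ≤ m) (hp : p ≤ m) (hq : q ≤ m) (hr : r ≤ m) :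
    blockIndex p q m r < m := by
  unfold blockIndex; split_ifs <;> omega

lemma IsNodes.eq_zero_or_one {p q m : ℕ} {t : Fin (m + 1) → ℝ} (ht : IsNodes p q m t)
    {r : Fin (m + 1)} (h : blockIndex p q m r ≠ 0) : t r = 0 ∨ t r = 1 := by
  unfold blockIndex at h
  split_ifs at h with h1 h2
  · exact Or.inl (ht.zero r h1)
  · exact Or.inr (ht.one r h2)
  · exact absurd rfl h

variable {k p q : ℕ} {t : Fin (k + 1) → ℝ}

lemma confluentDet_dualFun (hw : ∀ j, Continuous (w j)) (h0 : ∀ j y, w j y ≠ 0) (hk : 1 ≤ k)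
    (hp : p ≤ k) (hq : q ≤ k) (ht : IsNodes p q k t) :
    confluentDet (dualDeriv w k) t (fun j : Fin (k + 1) => dualFun w k (j + 1)) =
      (blockMatrix (dualFamily w) p q k t).det := by
  unfold confluentDet blockMatrix
  congr 1
  ext r j
  simp only [Matrix.of_apply, ht.repIndex_eq hq]
  rw [(isAdaptedChain_dualFun hw k j).dualDeriv_eq h0
    (blockIndex_lt hk hp hq (Nat.lt_succ_iff.1 r.2)) _ ⟨⟨ht.nonneg r, ht.le_one r⟩, trivial⟩]
  rfl

lemma confluentDet_gFun (hw : ∀ j, Continuous (w j)) (h0 : ∀ j y, w j y ≠ 0) (hk : 1 ≤ k)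
    (hp : p ≤ k) (hq : q ≤ k) (ht : IsNodes p q k t) {x : ℝ} (hx : x ≠ 0 ∨ k = 1) :
    confluentDet (dualDeriv w k) t
        (fun j : Fin (k + 1) => if (j : ℕ) < k then dualFun w k (j + 1) else gFun w k x) =
      (-1) ^ k * (blockMatrix (kernelFamily w x) p q k t).det := by
  have hv : ∏ j : Fin (k + 1), (if (j : ℕ) < k then (1 : ℝ) else (-1) ^ k) = (-1) ^ k := by
    rw [Fin.prod_univ_castSucc]; simp
  rw [← hv, ← Matrix.det_mul_row]
  unfold confluentDet blockMatrix
  congr 1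
  ext r j
  simp only [Matrix.of_apply, ht.repIndex_eq hq]
  have hlt := blockIndex_lt hk hp hq (Nat.lt_succ_iff.1 r.2)
  set d := blockIndex p q k r with hd
  have hmem : t r ∈ Icc (0 : ℝ) 1 := ⟨ht.nonneg r, ht.le_one r⟩
  by_cases hj : (j : ℕ) < k
  · simp only [hj, if_true, one_mul]
    rw [(isAdaptedChain_dualFun hw k j).dualDeriv_eq h0 hlt _ ⟨hmem, trivial⟩]
    refine if_congr Iff.rfl ?_ rfl
    by_cases hdj : d ≤ j
    · rw [kernelFamily, if_pos (by omega)]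
    · have : (j : ℕ) - d + 1 = 1 := by omega
      rw [kernelFamily, if_pos (by omega)]
  · have hjk : (j : ℕ) = k := by have := j.2; omega
    simp only [hjk, lt_irrefl, if_false, hlt.le, if_true, kernelFamily]
    rw [← mul_assoc, ← pow_add]
    -- The last column needs `(-1)^d g_{k-d}` while the family carries `(-1)^{k-d} g_{k-d}`; the
    -- ratio `(-1)^k` is the same in every row.
    have hsign : (-1 : ℝ) ^ (k + (k - d)) = (-1) ^ d := by
      rw [show k + (k - d) = d + 2 * (k - d) by omega, pow_add, pow_mul]; simp
    rw [hsign]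
    by_cases hd0 : d = 0
    · simp [hd0, dualDeriv]
    · refine (isAdaptedChain_gFun hw k x).dualDeriv_eq h0 hlt _ ⟨hmem, ?_⟩
      have hx0 : x ≠ 0 := hx.resolve_right (by omega)
      rcases ht.eq_zero_or_one hd0 with h | h
      · exact Or.inl (by rw [h]; exact hx0.symm)
      · by_cases h1 : x = 1
        · exact Or.inr h1
        · exact Or.inl (by rw [h]; exact Ne.symm h1)

lemma confluentDet_gFun_zero (h0 : ∀ j y, w j y ≠ 0) (hk : 2 ≤ k)
    (hp : p ≤ k) (hq : q ≤ k) (ht : IsNodes p q k t) :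
    confluentDet (dualDeriv w k) t
        (fun j : Fin (k + 1) => if (j : ℕ) < k then dualFun w k (j + 1) else gFun w k 0) = 0 := by
  refine Matrix.det_eq_zero_of_column_eq_zero (Fin.last k) fun r => ?_
  simp only [Matrix.of_apply, Fin.val_last, lt_irrefl, if_false, ht.repIndex_eq hq]
  exact (isAdaptedChain_gFun_zero hk).dualDeriv_eq h0
    (blockIndex_lt (by omega) hp hq (Nat.lt_succ_iff.1 r.2)) _
    ⟨⟨ht.nonneg r, ht.le_one r⟩, trivial⟩

end AdaptedDerivatives

/-! ### From grid sequences to nodes -/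

section Grid

lemma mem_iff_lt_card_of_isLowerSet {n : ℕ} {S : Finset (Fin n)}
    (hS : ∀ a ∈ S, ∀ b ≤ a, b ∈ S) (r : Fin n) : r ∈ S ↔ (r : ℕ) < S.card := by
  constructor
  · intro hr
    have h := Finset.card_le_card (show Finset.Iic r ⊆ S from fun b hb =>
      hS r hr b (Finset.mem_Iic.1 hb))
    rw [Fin.card_Iic] at h
    omega
  · intro hr
    by_contra hn
    have h := Finset.card_le_card (show S ⊆ Finset.Iio r from fun b hb =>
      Finset.mem_Iio.2 (lt_of_not_ge fun hle => hn (hS b hb r hle)))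
    rw [Fin.card_Iio] at h
    omega

lemma mem_iff_le_add_card_of_isUpperSet {n : ℕ} {S : Finset (Fin n)}
    (hS : ∀ a ∈ S, ∀ b, a ≤ b → b ∈ S) (r : Fin n) : r ∈ S ↔ n ≤ (r : ℕ) + S.card := by
  have hr' := r.2
  constructor
  · intro hr
    have h := Finset.card_le_card (show Finset.Ici r ⊆ S from fun b hb =>
      hS r hr b (Finset.mem_Ici.1 hb))
    rw [Fin.card_Ici] at h
    omega
  · intro hr
    by_contra hn
    have h := Finset.card_le_card (show S ⊆ Finset.Ioi r from fun b hb =>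
      Finset.mem_Ioi.2 (lt_of_not_ge fun hle => hn (hS b hb r hle)))
    rw [Fin.card_Ioi] at h
    omega

lemma gridPoints_subset (𝓕 : MeasurableSpace (Icc (0 : ℝ) 1)) : gridPoints 𝓕 ⊆ Icc 0 1 := by
  rintro s ⟨p, hs⟩
  refine closure_minimal ?_ isClosed_Icc (frontier_subset_closure hs)
  rintro _ ⟨y, -, rfl⟩
  exact y.2

variable {k n i : ℕ} {𝓕 : MeasurableSpace (Icc (0 : ℝ) 1)} {t : ℕ → ℝ}

lemma IsGridSequence.mem_Icc (ht : IsGridSequence k 𝓕 n t) {j : ℕ} (hj : j ≤ n) :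
    t j ∈ Icc (0 : ℝ) 1 := by
  classical
  have h := ht.count (t j)
  have hpos : 0 < ((Finset.range (n + 1)).filter fun i => t i = t j).card :=
    Finset.card_pos.2 ⟨j, by simp; omega⟩
  split_ifs at h with h1 h2
  · rcases h1 with h1 | h1 <;> rw [h1] <;> simp
  · exact gridPoints_subset 𝓕 h2
  · have : ((Finset.range (n + 1)).filter fun i => t i = t j).card = 0 := by rw [← h]
    omega

lemma IsGridSequence.eq_zero_or_one (ht : IsGridSequence k 𝓕 n t) {j j' : ℕ} (hjj : j < j')
    (hj : j' ≤ n) (h : t j = t j') : t j = 0 ∨ t j = 1 := by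
  classical
  by_contra hn
  have hc := ht.count (t j)
  rw [if_neg hn] at hc
  have h2 : 2 ≤ ((Finset.range (n + 1)).filter fun i => t i = t j).card := by
    rw [← Finset.card_pair hjj.ne]
    refine Finset.card_le_card fun a ha => ?_
    simp only [Finset.mem_insert, Finset.mem_singleton] at ha
    rcases ha with rfl | rfl
    · simp; omega
    · simp [h]; omega
  have h3 : ((Finset.range (n + 1)).filter fun i => t i = t j).card ≤ 1 := by
    rw [show ((Finset.range (n + 1)).filter fun i => t i = t j).card = _ from hc]
    split_ifs <;> omega
  omega

lemma IsGridSequence.card_le (ht : IsGridSequence k 𝓕 n t) (hi : i + k ≤ n) {s : ℝ}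
    (hs : s = 0 ∨ s = 1) :
    (Finset.univ.filter fun r : Fin (k + 1) => t (i + r) = s).card ≤ k := by
  classical
  have hc := ht.count s
  rw [if_pos hs] at hc
  calc _ ≤ ((Finset.range (n + 1)).filter fun i => t i = s).card := by
        refine Finset.card_le_card_of_injOn (fun r : Fin (k + 1) => i + r) (fun r hr => ?_) ?_
        · have := r.2
          simp only [Finset.coe_filter, Finset.mem_univ, true_and, mem_ofPred_eq] at hr
          simp [hr]; omega
        · intro a _ b _ hab
          exact Fin.ext (by simpa using hab)
    _ = k := by rw [← hc]

/-- `p` and `q` are the numbers of nodes equal to `0` and `1`. Monotonicity makes them initial and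
final blocks, and the multiplicities of the grid exclude any other coincidence. -/
lemma IsGridSequence.exists_isNodes (ht : IsGridSequence k 𝓕 n t) (hi : i + k ≤ n) :
    ∃ p q, p ≤ k ∧ q ≤ k ∧ IsNodes p q k fun r => t (i + r) := by
  classical
  have hmem : ∀ r : Fin (k + 1), t (i + r) ∈ Icc (0 : ℝ) 1 := fun r =>
    ht.mem_Icc (by have := r.2; omega)
  have hmono : ∀ r r' : Fin (k + 1), r ≤ r' → t (i + r) ≤ t (i + r') := fun r r' h =>
    ht.monotone _ _ (by have := Fin.le_def.1 h; omega) (by have := r'.2; omega)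
  have h0 : ∀ r : Fin (k + 1), t (i + r) = 0 ↔ (r : ℕ) <
      (Finset.univ.filter fun r : Fin (k + 1) => t (i + r) = 0).card := by
    intro r
    rw [← mem_iff_lt_card_of_isLowerSet]
    · simp
    · intro a ha b hb
      simp only [Finset.mem_filter, Finset.mem_univ, true_and] at ha ⊢
      exact le_antisymm (ha ▸ hmono _ _ hb) (hmem b).1
  have h1 : ∀ r : Fin (k + 1), t (i + r) = 1 ↔ k + 1 ≤ (r : ℕ) +
      (Finset.univ.filter fun r : Fin (k + 1) => t (i + r) = 1).card := by
    intro r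
    rw [← mem_iff_le_add_card_of_isUpperSet]
    · simp
    · intro a ha b hb
      simp only [Finset.mem_filter, Finset.mem_univ, true_and] at ha ⊢
      exact le_antisymm (hmem b).2 (ha ▸ hmono _ _ hb)
  refine ⟨_, _, ht.card_le hi (Or.inl rfl), ht.card_le hi (Or.inr rfl),
    fun r hr => (h0 r).2 hr, fun r hr => (h1 r).2 hr,
    fun r hr => (hmem r).1.lt_of_ne fun h => ?_, fun r hr => (hmem r).2.lt_of_ne fun h => ?_,
    fun r r' hrr hr' hr => (hmono r r' hrr.le).lt_of_ne fun h => ?_⟩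
  · exact hr.not_gt ((h0 r).1 h.symm)
  · exact hr.not_ge ((h1 r).1 h)
  · rcases ht.eq_zero_or_one (by have := Fin.lt_def.1 hrr; omega)
      (by have := r'.2; omega) h with h' | h'
    · exact hr'.not_gt ((h0 r').1 (h.symm.trans h'))
    · exact hr.not_ge ((h1 r).1 h')

end Grid

/-! ### Passing to weights on the whole line -/

section Extension

lemma nestedIntegral_congr {ι : Type*} {l : List ι} {f g : ι → ℝ → ℝ}
    (h : ∀ r ∈ l, EqOn (f r) (g r) (Icc 0 1)) {a x : ℝ} (ha : a ∈ Icc (0 : ℝ) 1)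
    (hx : x ∈ Icc (0 : ℝ) 1) : nestedIntegral a (l.map f) x = nestedIntegral a (l.map g) x := by
  induction l generalizing x with
  | nil => rfl
  | cons r l ih =>
    simp only [List.map_cons, nestedIntegral]
    refine intervalIntegral.integral_congr fun s hs => ?_
    have hs' : s ∈ Icc (0 : ℝ) 1 := (ordConnected_Icc.uIcc_subset ha hx) hs
    rw [h r (by simp) hs', ih (fun r' hr' => h r' (by simp [hr'])) hs']

variable {w W : ℕ → ℝ → ℝ} {k : ℕ}

lemma dualFun_congr (h : ∀ j ∈ Finset.Icc 1 k, EqOn (w j) (W j) (Icc 0 1)) {j : ℕ} (hj : j ≤ k) :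
    EqOn (dualFun w k (j + 1)) (dualFun W k (j + 1)) (Icc 0 1) := fun y hy => by
  refine nestedIntegral_congr (fun r hr => h _ ?_) (by simp) hy
  rw [List.mem_range] at hr
  rw [Finset.mem_Icc]
  omega

lemma gFun_congr (hk : 1 ≤ k) (h : ∀ j ∈ Finset.Icc 1 k, EqOn (w j) (W j) (Icc 0 1)) {x : ℝ}
    (hx : x ∈ Icc (0 : ℝ) 1) : EqOn (gFun w k x) (gFun W k x) (Icc 0 1) := fun y hy => by
  unfold gFun hFun
  rw [h 1 (by simp [hk]) hx, nestedIntegral_congr (fun r hr => h _ ?_) hy hx]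
  rw [List.mem_range] at hr
  rw [Finset.mem_Icc]
  omega

lemma dualDeriv_congr (h : ∀ j ∈ Finset.Icc 1 k, EqOn (w j) (W j) (Icc 0 1)) {f g : ℝ → ℝ}
    (hfg : EqOn f g (Icc 0 1)) {d : ℕ} (hd : d ≤ k) :
    EqOn (dualDeriv w k d f) (dualDeriv W k d g) (Icc 0 1) := by
  induction d with
  | zero => exact hfg
  | succ d ih =>
    intro y hy
    have ih := ih (by omega)
    simp only [dualDeriv]
    rw [derivWithin_congr ih (ih hy), h (k - d) (by rw [Finset.mem_Icc]; omega) hy]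

lemma confluentDet_congr {L L' : ℕ → (ℝ → ℝ) → ℝ → ℝ} {m : ℕ} {s : Fin m → ℝ}
    {u u' : Fin m → ℝ → ℝ} (hs : ∀ r, s r ∈ Icc (0 : ℝ) 1)
    (h : ∀ r j, EqOn (L (repIndex s r) (u j)) (L' (repIndex s r) (u' j)) (Icc 0 1)) :
    confluentDet L s u = confluentDet L' s u' := by
  unfold confluentDet
  congr 1
  ext r j
  exact h r j (hs r)

lemma bsplineQuotient_congr {L L' : ℕ → (ℝ → ℝ) → ℝ → ℝ} (hk : 1 ≤ k)
    (h : ∀ j ∈ Finset.Icc 1 k, EqOn (w j) (W j) (Icc 0 1))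
    (hL : ∀ d < k, ∀ f g, EqOn f g (Icc 0 1) → EqOn (L d f) (L' d g) (Icc 0 1))
    {p q i : ℕ} (hp : p ≤ k) (hq : q ≤ k) {t : ℕ → ℝ}
    (ht : IsNodes p q k fun r => t (i + r)) {x : ℝ} (hx : x ∈ Icc (0 : ℝ) 1) :
    bsplineQuotient L w k t i x = bsplineQuotient L' W k t i x := by
  have hs : ∀ r : Fin (k + 1), t (i + r) ∈ Icc (0 : ℝ) 1 := fun r => ⟨ht.nonneg r, ht.le_one r⟩
  have hr : ∀ r : Fin (k + 1), repIndex (fun r : Fin (k + 1) => t (i + r)) r < k := fun r => by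
    rw [ht.repIndex_eq hq]
    exact blockIndex_lt hk hp hq (Nat.lt_succ_iff.1 r.2)
  unfold bsplineQuotient
  congr 2
  · refine confluentDet_congr hs fun r j => hL _ (hr r) _ _ ?_
    split_ifs with hj
    · exact dualFun_congr h hj.le
    · exact gFun_congr hk h hx
  · exact confluentDet_congr hs fun r j => hL _ (hr r) _ _
      (dualFun_congr h (Nat.lt_succ_iff.1 j.2))

/-- Constant extension beyond `0` and `1` destroys smoothness, but the determinant formulas need
only continuity and positivity, and derivatives are always taken within `[0,1]`. -/
lemma exists_global_weights {M : ℝ} (hM : 0 < M)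
    (hc : ∀ j ∈ Finset.Icc 1 k, ContinuousOn (w j) (Icc 0 1))
    (hb : ∀ j ∈ Finset.Icc 1 k, ∀ x ∈ Icc (0 : ℝ) 1, 1 / M ≤ w j x ∧ w j x ≤ M) :
    ∃ W : ℕ → ℝ → ℝ, (∀ j, Continuous (W j)) ∧ (∀ j y, 0 < W j y) ∧
      ∀ j ∈ Finset.Icc 1 k, EqOn (w j) (W j) (Icc 0 1) := by
  refine ⟨fun j => if j ∈ Finset.Icc 1 k then
    IccExtend zero_le_one ((Icc (0 : ℝ) 1).domRestrict (w j)) else fun _ => 1, fun j => ?_,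
    fun j y => ?_, fun j hj y hy => ?_⟩
  · simp only
    split_ifs with h
    · exact (continuousOn_iff_continuous_domRestrict.1 (hc j h)).Icc_extend'
    · exact continuous_const
  · simp only
    split_ifs with h
    · exact (one_div_pos.2 hM).trans_le (hb j h _ (Subtype.mem _)).1
    · exact one_pos
  · simp only [if_pos hj]
    rw [IccExtend_of_mem _ _ hy]
    rfl

end Extension

/-! ### Splines as quotients of block determinants -/

section Splines

variable {w : ℕ → ℝ → ℝ} {k p q i : ℕ} {t : ℕ → ℝ}

lemma chebBSpline_eq (hw : ∀ j, Continuous (w j)) (h0 : ∀ j y, w j y ≠ 0) (hk : 1 ≤ k)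
    (hp : p ≤ k) (hq : q ≤ k) (ht : IsNodes p q k fun r => t (i + r)) {x : ℝ}
    (hx : x ≠ 0 ∨ k = 1) :
    chebBSpline w k t i x = (blockMatrix (kernelFamily w x) p q k fun r => t (i + r)).det /
      (blockMatrix (dualFamily w) p q k fun r => t (i + r)).det := by
  unfold chebBSpline bsplineQuotient
  rw [confluentDet_gFun hw h0 hk hp hq ht hx, confluentDet_dualFun hw h0 hk hp hq ht,
    ← mul_div_assoc, ← mul_assoc, ← mul_pow]
  simp

lemma chebBSpline_zero (h0 : ∀ j y, w j y ≠ 0) (hk : 2 ≤ k)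
    (hp : p ≤ k) (hq : q ≤ k) (ht : IsNodes p q k fun r => t (i + r)) :
    chebBSpline w k t i 0 = 0 := by
  unfold chebBSpline bsplineQuotient
  rw [confluentDet_gFun_zero h0 hk hp hq ht]
  simp

lemma chebBSplineOrd_eq (hw : ∀ j, Continuous (w j)) (h0 : ∀ j y, w j y ≠ 0) (hk : 1 ≤ k)
    (hsm : ∀ j ∈ Finset.Icc 1 k, ContDiffOn ℝ ((j - 2 : ℕ) : WithTop ℕ∞) (w j) (Icc 0 1))
    (hp : p ≤ k) (hq : q ≤ k) (ht : IsNodes p q k fun r => t (i + r)) (x : ℝ) :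
    chebBSplineOrd w k t i x = chebBSpline w k t i x := by
  have hs : ∀ r : Fin (k + 1), t (i + r) ∈ Icc (0 : ℝ) 1 := fun r => ⟨ht.nonneg r, ht.le_one r⟩
  have hr : ∀ r : Fin (k + 1), repIndex (fun r : Fin (k + 1) => t (i + r)) r < k := fun r => by
    rw [ht.repIndex_eq hq]
    exact blockIndex_lt hk hp hq (Nat.lt_succ_iff.1 r.2)
  have hg : ∃ O F, IsAdaptedChain w k O (gFun w k x) F ∧ ∀ r : Fin (k + 1),
      repIndex (fun r : Fin (k + 1) => t (i + r)) r = 0 ∨ t (i + r) ∈ O := by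
    by_cases hx : x = 0 ∧ 2 ≤ k
    · obtain ⟨rfl, hk2⟩ := hx
      exact ⟨_, _, isAdaptedChain_gFun_zero hk2, fun r => Or.inr trivial⟩
    · refine ⟨_, _, isAdaptedChain_gFun hw k x, fun r => or_iff_not_imp_left.2 fun hd => ?_⟩
      have hx0 : x ≠ 0 := fun h => hx ⟨h, by have := hr r; omega⟩
      rw [ht.repIndex_eq hq] at hd
      rcases ht.eq_zero_or_one hd with h | h
      · exact Or.inl (by rw [h]; exact hx0.symm)
      · by_cases h1 : x = 1
        · exact Or.inr h1
        · exact Or.inl (by rw [h]; exact Ne.symm h1)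
  unfold chebBSplineOrd chebBSpline bsplineQuotient
  rw [confluentDet_ordDeriv _ h0 hsm hs hr, confluentDet_ordDeriv _ h0 hsm hs hr,
    mul_div_mul_left _ _ (transitionMatrix_det_ne_zero _ h0 k)]
  · exact fun j => ⟨_, _, isAdaptedChain_dualFun hw k j, fun r => Or.inr trivial⟩
  · intro j
    split_ifs with hj
    · exact ⟨_, _, isAdaptedChain_dualFun hw k j, fun r => Or.inr trivial⟩
    · exact hg

lemma polyBSpline_eq_chebBSpline (hk : 1 ≤ k) (hp : p ≤ k) (hq : q ≤ k)
    (ht : IsNodes p q k fun r => t (i + r)) (x : ℝ) :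
    polyBSpline k t i x = chebBSpline (fun _ _ => 1) k t i x :=
  chebBSplineOrd_eq (fun _ => continuous_const) (fun _ _ => one_ne_zero) hk
    (fun _ _ => contDiffOn_const) hp hq ht x

/-- The closure lies between the open and the closed interval from `t i` to `t (i + k)`, by strict
positivity inside and vanishing outside. -/
lemma suppLength_eq (hk : 1 ≤ k) (hp : p ≤ k) (hq : q ≤ k)
    (ht : IsNodes p q k fun r => t (i + r)) : suppLength k t i = t (i + k) - t i := by
  have hc1 : ∀ j : ℕ, Continuous ((fun _ _ => 1 : ℕ → ℝ → ℝ) j) := fun _ => continuous_const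
  have h01 : ∀ (j : ℕ) (y : ℝ), (fun _ _ => 1 : ℕ → ℝ → ℝ) j y ≠ 0 := fun _ _ => one_ne_zero
  have hfirst : ∀ y, y < (fun r : Fin (k + 1) => t (i + r)) 0 ↔ y < t i := fun y => by simp
  have hle : closure {x ∈ Icc (0 : ℝ) 1 | polyBSpline k t i x ≠ 0} ⊆ Icc (t i) (t (i + k)) := by
    refine closure_minimal (fun x hx => ?_) isClosed_Icc
    by_contra hn
    apply hx.2
    rw [polyBSpline_eq_chebBSpline hk hp hq ht]
    by_cases h : x = 0 ∧ 2 ≤ k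
    · obtain ⟨rfl, hk2⟩ := h
      exact chebBSpline_zero h01 hk2 hp hq ht
    · rw [chebBSpline_eq hc1 h01 hk hp hq ht (by
        by_cases hx0 : x = 0
        · exact Or.inr (by by_contra; exact h ⟨hx0, by omega⟩)
        · exact Or.inl hx0), kernelFamily_det_eq_zero hc1 hk hp hq ht (by simpa using hn), zero_div]
  have hge : Ioo (t i) (t (i + k)) ⊆ closure {x ∈ Icc (0 : ℝ) 1 | polyBSpline k t i x ≠ 0} := by
    refine Subset.trans (fun x hx => ?_) subset_closure
    have hi0 : 0 ≤ t i := by simpa using ht.nonneg 0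
    have hi1 : t (i + k) ≤ 1 := by simpa using ht.le_one (Fin.last k)
    have hx0 : 0 < x := hi0.trans_lt hx.1
    refine ⟨⟨hx0.le, hx.2.le.trans hi1⟩, ?_⟩
    rw [polyBSpline_eq_chebBSpline hk hp hq ht, chebBSpline_eq hc1 h01 hk hp hq ht (Or.inl hx0.ne')]
    exact (div_pos (kernelFamily_det_pos hc1 (fun _ _ => one_pos) hk hp hq ht (by simpa using hx.1)
      (by simpa using hx.2)) (dualFamily_det_pos hc1 (fun _ _ => one_pos) hk hp hq ht)).ne'
  have hlt : t i < t (i + k) := by simpa using ht.first_lt_last hk hp hq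
  have hvol : volume (closure {x ∈ Icc (0 : ℝ) 1 | polyBSpline k t i x ≠ 0}) =
      ENNReal.ofReal (t (i + k) - t i) :=
    le_antisymm ((measure_mono hle).trans_eq Real.volume_Icc)
      (Real.volume_Ioo.symm.trans_le (measure_mono hge))
  rw [suppLength, measureReal_def, hvol, ENNReal.toReal_ofReal (sub_pos.2 hlt).le]

end Splines

/-! ### Quantitative estimates -/

section Estimates

lemma one_add_pow_sub_one_le {x : ℝ} (hx : 0 ≤ x) (N : ℕ) :
    (1 + x) ^ N - 1 ≤ N * x * (1 + x) ^ N := by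
  induction N with
  | zero => simp
  | succ N ih =>
    have h1 : 0 ≤ (1 + x) ^ N := by positivity
    have h2 : (1 + x) ^ N ≤ (1 + x) ^ (N + 1) := pow_le_pow_right₀ (by linarith) (Nat.le_succ N)
    have h3 : 0 ≤ (N + 1 : ℝ) * x := by positivity
    calc (1 + x) ^ (N + 1) - 1 = ((1 + x) ^ N - 1) + x * (1 + x) ^ N := by ring
      _ ≤ N * x * (1 + x) ^ N + x * (1 + x) ^ N := by linarith
      _ = (N + 1) * x * (1 + x) ^ N := by ring
      _ ≤ (N + 1) * x * (1 + x) ^ (N + 1) := mul_le_mul_of_nonneg_left h2 h3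
      _ = _ := by push_cast; ring

/-- If numerator and denominator both change by the same factor up to a power of `θ`, then the
quotient changes little. -/
lemma abs_div_sub_div_le {U V U₁ V₁ A T : ℝ} (hU : 0 < U) (hU₁ : 0 < U₁) (hV₁ : 0 ≤ V₁)
    (hT : 1 ≤ T) (h1 : A * U₁ ≤ T * U) (h2 : U ≤ T * (A * U₁))
    (h3 : A * V₁ ≤ T * V) (h4 : V ≤ T * (A * V₁)) :
    V / U ≤ T ^ 2 * (V₁ / U₁) ∧ |V / U - V₁ / U₁| ≤ (T ^ 2 - 1) * (V₁ / U₁) := by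
  have hT0 : 0 < T := one_pos.trans_le hT
  have a1 : V / U ≤ T ^ 2 * (V₁ / U₁) := by
    rw [← mul_div_assoc, div_le_div_iff₀ hU hU₁]
    calc V * U₁ ≤ T * (A * V₁) * U₁ := mul_le_mul_of_nonneg_right h4 hU₁.le
      _ = T * V₁ * (A * U₁) := by ring
      _ ≤ T * V₁ * (T * U) := mul_le_mul_of_nonneg_left h1 (by positivity)
      _ = T ^ 2 * V₁ * U := by ring
  have a2 : V₁ / U₁ ≤ T ^ 2 * (V / U) := by
    rw [← mul_div_assoc, div_le_div_iff₀ hU₁ hU]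
    calc V₁ * U ≤ V₁ * (T * (A * U₁)) := mul_le_mul_of_nonneg_left h2 hV₁
      _ = T * U₁ * (A * V₁) := by ring
      _ ≤ T * U₁ * (T * V) := mul_le_mul_of_nonneg_left h3 (by positivity)
      _ = T ^ 2 * V * U₁ := by ring
  refine ⟨a1, ?_⟩
  have hT2 : 0 ≤ T ^ 2 - 1 := by nlinarith
  rw [abs_le]
  constructor
  · rcases le_total (V₁ / U₁) (V / U) with h | h
    · have := mul_nonneg hT2 (div_nonneg hV₁ hU₁.le)
      linarith
    -- By `a2` the difference is at most `(T ^ 2 - 1) * (V / U)`, and here `V / U` is the smaller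
    -- quotient.
    · have := mul_le_mul_of_nonneg_left h hT2
      linarith
  · linarith

variable {M : ℝ} {f : ℝ → ℝ}

lemma abs_sub_le_of_bounds (hM : 0 < M) (hf : ∀ x ∈ Icc (0 : ℝ) 1, 1 / M ≤ f x ∧ f x ≤ M)
    {x y : ℝ} (hx : x ∈ Icc (0 : ℝ) 1) (hy : y ∈ Icc (0 : ℝ) 1) : |f x - f y| ≤ M := by
  have h := one_div_pos.2 hM
  have := hf x hx
  have := hf y hy
  rw [abs_le]
  constructor <;> linarith

lemma modulus_nonneg (f : ℝ → ℝ) (δ : ℝ) : 0 ≤ modulus f δ := by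
  refine Real.sSup_nonneg ?_
  rintro r ⟨x, -, y, -, -, rfl⟩
  exact abs_nonneg _

lemma modulus_le (hM : 0 < M) (hf : ∀ x ∈ Icc (0 : ℝ) 1, 1 / M ≤ f x ∧ f x ≤ M) (δ : ℝ) :
    modulus f δ ≤ M := by
  refine Real.sSup_le ?_ hM.le
  rintro r ⟨x, hx, y, hy, -, rfl⟩
  exact abs_sub_le_of_bounds hM hf hx hy

lemma abs_sub_le_modulus (hM : 0 < M) (hf : ∀ x ∈ Icc (0 : ℝ) 1, 1 / M ≤ f x ∧ f x ≤ M)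
    {δ x y : ℝ} (hx : x ∈ Icc (0 : ℝ) 1) (hy : y ∈ Icc (0 : ℝ) 1) (h : |x - y| < δ) :
    |f x - f y| ≤ modulus f δ := by
  refine le_csSup ⟨M, ?_⟩ ⟨x, hx, y, hy, h, rfl⟩
  rintro r ⟨x, hx, y, hy, -, rfl⟩
  exact abs_sub_le_of_bounds hM hf hx hy

/-- The estimates for globally defined positive continuous weights. -/
lemma chebBSpline_estimates {m : ℕ} {W : ℕ → ℝ → ℝ} (hM : 0 < M) (hW : ∀ j, Continuous (W j))
    (h0 : ∀ j y, 0 < W j y) {p q i : ℕ} {t : ℕ → ℝ} (hp : p ≤ m + 1) (hq : q ≤ m + 1)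
    (ht : IsNodes p q (m + 1) fun r => t (i + r)) {Ω : ℝ} (hΩ0 : 0 ≤ Ω) (hΩM : Ω ≤ M)
    {a : ℕ → ℝ} (ha : ∀ j, 0 < a j)
    (hle : ∀ j, 1 ≤ j → j ≤ m + 1 → ∀ y ∈ Icc (t i) (t (i + (m + 1))), W j y ≤ (1 + M * Ω) * a j)
    (hge : ∀ j, 1 ≤ j → j ≤ m + 1 → ∀ y ∈ Icc (t i) (t (i + (m + 1))), a j ≤ (1 + M * Ω) * W j y)
    {x : ℝ} (hx : x ≠ 0 ∨ m + 1 = 1) {N : ℕ} (hN : N = 2 * (m + 1) ^ 2) {C₀ Θ : ℝ}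
    (hC₀ : C₀ = 2 ^ m * (m + 1).factorial) (hΘ : Θ = 1 + M * M) :
    |chebBSpline W (m + 1) t i x - polyBSpline (m + 1) t i x| ≤
        C₀ * Θ ^ N * (N * M + 1) / (t (i + (m + 1)) - t i) * Ω ∧
      |chebBSpline W (m + 1) t i x| ≤ C₀ * Θ ^ N * (N * M + 1) / (t (i + (m + 1)) - t i) := by
  have hc1 : ∀ j : ℕ, Continuous ((fun _ _ => 1 : ℕ → ℝ → ℝ) j) := fun _ => continuous_const
  have h01 : ∀ (j : ℕ) (y : ℝ), 0 < (fun _ _ => 1 : ℕ → ℝ → ℝ) j y := fun _ _ => one_pos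
  have hk : 1 ≤ m + 1 := Nat.le_add_left 1 m
  have hMΩ : 0 ≤ M * Ω := mul_nonneg hM.le hΩ0
  have hθ : 1 ≤ 1 + M * Ω := by linarith
  have hθΘ : 1 + M * Ω ≤ Θ := by
    rw [hΘ]; linarith [mul_le_mul_of_nonneg_left hΩM hM.le]
  have hδ : 0 < t (i + (m + 1)) - t i := by
    simpa using sub_pos.2 (ht.first_lt_last hk hp hq)
  obtain ⟨⟨u1, u2⟩, v1, v2⟩ := family_det_compare hW (fun j y => (h0 j y).le) hθ ha hp hq ht
    (by simpa using hle) (by simpa using hge) x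
  have hlen := kernelFamily_det_mul_length_le x hp hq ht
  have hU := dualFamily_det_pos hW h0 hk hp hq ht
  have hU₁ := dualFamily_det_pos hc1 h01 hk hp hq ht
  have hV := blockMatrix_det_nonneg (isIntegralFamily_kernelFamily hW x)
    (fun j y => (h0 j y).le) (monotone_kernelFamily (fun j y => (h0 j y).le) x) hk hp hq ht
  have hV₁ := blockMatrix_det_nonneg (isIntegralFamily_kernelFamily hc1 x)
    (fun j y => (h01 j y).le) (monotone_kernelFamily (fun j y => (h01 j y).le) x) hk hp hq ht
  -- Here `T = θ ^ ((m + 1) ^ 2)` with `θ = 1 + M * Ω`, so that `T ^ 2 = θ ^ N`.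
  obtain ⟨b1, b2⟩ := abs_div_sub_div_le hU hU₁ hV₁
    (one_le_pow₀ hθ) u1 u2 v1 v2
  rw [← pow_mul, show (m + 1) ^ 2 * 2 = N by rw [hN]; ring] at b1 b2
  rw [← chebBSpline_eq hW (fun j y => (h0 j y).ne') hk hp hq ht hx,
    ← chebBSpline_eq hc1 (fun j y => (h01 j y).ne') hk hp hq ht hx,
    ← polyBSpline_eq_chebBSpline hk hp hq ht] at b1 b2
  have hb0 : 0 ≤ chebBSpline W (m + 1) t i x := by
    rw [chebBSpline_eq hW (fun j y => (h0 j y).ne') hk hp hq ht hx]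
    exact div_nonneg hV hU.le
  have hP0 : 0 ≤ polyBSpline (m + 1) t i x := by
    rw [polyBSpline_eq_chebBSpline hk hp hq ht,
      chebBSpline_eq hc1 (fun j y => (h01 j y).ne') hk hp hq ht hx]
    exact div_nonneg hV₁ hU₁.le
  have hP1 : polyBSpline (m + 1) t i x ≤ C₀ / (t (i + (m + 1)) - t i) := by
    rw [polyBSpline_eq_chebBSpline hk hp hq ht,
      chebBSpline_eq hc1 (fun j y => (h01 j y).ne') hk hp hq ht hx,
      div_le_div_iff₀ hU₁ hδ, mul_comm, hC₀]
    simpa using hlen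
  set δ := t (i + (m + 1)) - t i
  have hC₀0 : 0 ≤ C₀ := by rw [hC₀]; positivity
  have hΘ0 : 0 ≤ Θ := by rw [hΘ]; positivity
  have hpow : (1 + M * Ω) ^ N ≤ Θ ^ N := pow_le_pow_left₀ (by linarith) hθΘ N
  have hNM : (0 : ℝ) ≤ N * M := by positivity
  have hK : 0 ≤ C₀ * Θ ^ N / δ := by positivity
  constructor
  · refine b2.trans ?_
    have e1 : (1 + M * Ω) ^ N - 1 ≤ N * (M * Ω) * Θ ^ N :=
      (one_add_pow_sub_one_le hMΩ N).trans (mul_le_mul_of_nonneg_left hpow (by positivity))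
    calc ((1 + M * Ω) ^ N - 1) * polyBSpline (m + 1) t i x
        ≤ (N * (M * Ω) * Θ ^ N) * (C₀ / δ) := mul_le_mul e1 hP1 hP0 (by positivity)
      _ = C₀ * Θ ^ N / δ * Ω * (N * M) := by ring
      _ ≤ C₀ * Θ ^ N / δ * Ω * (N * M + 1) :=
        mul_le_mul_of_nonneg_left (by linarith) (mul_nonneg hK hΩ0)
      _ = _ := by ring
  · rw [abs_of_nonneg hb0]
    calc chebBSpline W (m + 1) t i x ≤ (1 + M * Ω) ^ N * polyBSpline (m + 1) t i x := b1
      _ ≤ Θ ^ N * (C₀ / δ) := mul_le_mul hpow hP1 hP0 (by positivity)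
      _ = C₀ * Θ ^ N / δ * 1 := by ring
      _ ≤ C₀ * Θ ^ N / δ * (N * M + 1) := mul_le_mul_of_nonneg_left (by linarith) hK
      _ = _ := by ring

end Estimates

end

end ChebSpline

/-! ### The main theorem -/

theorem mainTheorem4 (k : ℕ) (hk : 1 ≤ k) (M : ℝ) (hM : 0 < M) :
    ∃ C : ℝ, 0 < C ∧ ∀ w : ℕ → ℝ → ℝ,
      (∀ j ∈ Finset.Icc 1 k, ContDiffOn ℝ ((k - j + 1 : ℕ) : WithTop ℕ∞) (w j) (Icc 0 1)) →
      (∀ j ∈ Finset.Icc 1 k, ∀ x ∈ Icc (0 : ℝ) 1, 1 / M ≤ w j x ∧ w j x ≤ M) →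
      ∀ 𝓕 : MeasurableSpace (Icc (0 : ℝ) 1), ChebSpline.IsIntervalSigmaAlgebra 𝓕 →
      ∀ (n : ℕ) (t : ℕ → ℝ), ChebSpline.IsGridSequence k 𝓕 n t →
      ∀ i : ℕ, i + k ≤ n → ∀ x ∈ Icc (0 : ℝ) 1,
        (|ChebSpline.chebBSpline w k t i x - ChebSpline.polyBSpline k t i x| ≤
          C / ChebSpline.suppLength k t i *
            (Finset.Icc 1 k).sup' (Finset.nonempty_Icc.mpr hk)
              (fun j => ChebSpline.modulus (w j) (ChebSpline.suppLength k t i))) ∧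
        |ChebSpline.chebBSpline w k t i x| ≤ C / ChebSpline.suppLength k t i ∧
        ((∀ j ∈ Finset.Icc 1 k, ContDiffOn ℝ ((j - 2 : ℕ) : WithTop ℕ∞) (w j) (Icc 0 1)) →
          ChebSpline.chebBSplineOrd w k t i x = ChebSpline.chebBSpline w k t i x) := by
  obtain ⟨m, rfl⟩ : ∃ m, k = m + 1 := ⟨k - 1, by omega⟩
  obtain ⟨C₀, hC₀⟩ : ∃ C₀ : ℝ, C₀ = 2 ^ m * (m + 1).factorial := ⟨_, rfl⟩
  obtain ⟨Θ, hΘ⟩ : ∃ Θ : ℝ, Θ = 1 + M * M := ⟨_, rfl⟩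
  obtain ⟨N, hN⟩ : ∃ N : ℕ, N = 2 * (m + 1) ^ 2 := ⟨_, rfl⟩
  have hC₀0 : 0 < C₀ := by rw [hC₀]; positivity
  have hΘ0 : 0 < Θ := by rw [hΘ]; positivity
  -- `C₀` bounds the polynomial spline times its support length, and `Θ` bounds `1 + MΩ` because `Ω
  -- ≤ M`. The term `N * M` comes from `θ ^ N - 1 ≤ N * (M * Ω) * θ ^ N`, and the summand `1` serves
  -- the second estimate.
  refine ⟨C₀ * Θ ^ N * (N * M + 1), by positivity, ?_⟩
  intro w hsm hb 𝓕 _ n t ht i hi x hx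
  obtain ⟨p, q, hp, hq, hnode⟩ := ht.exists_isNodes hi
  obtain ⟨W, hW, hW0, hwW⟩ := ChebSpline.exists_global_weights hM
    (fun j hj => (hsm j hj).continuousOn) hb
  have hWne : ∀ j y, W j y ≠ 0 := fun j y => (hW0 j y).ne'
  have hcheb : ChebSpline.chebBSpline w (m + 1) t i x = ChebSpline.chebBSpline W (m + 1) t i x :=
    ChebSpline.bsplineQuotient_congr (L := ChebSpline.dualDeriv w (m + 1))
      (L' := ChebSpline.dualDeriv W (m + 1)) hk hwW
      (fun d hd f g hfg => ChebSpline.dualDeriv_congr hwW hfg hd.le) hp hq hnode hx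
  have hord : ChebSpline.chebBSplineOrd w (m + 1) t i x =
      ChebSpline.chebBSplineOrd W (m + 1) t i x :=
    ChebSpline.bsplineQuotient_congr (L := ChebSpline.ordDeriv) (L' := ChebSpline.ordDeriv) hk hwW
      (fun d _ f g hfg y hy => iteratedDerivWithin_congr hfg hy) hp hq hnode hx
  have hlt : t i < t (i + (m + 1)) := by simpa using hnode.first_lt_last hk hp hq
  rw [ChebSpline.suppLength_eq hk hp hq hnode, hcheb, hord, ← and_assoc]
  set δ := t (i + (m + 1)) - t i with hδ
  set Ω := (Finset.Icc 1 (m + 1)).sup' (Finset.nonempty_Icc.mpr hk)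
    (fun j => ChebSpline.modulus (w j) δ) with hΩ
  have hΩle : ∀ j ∈ Finset.Icc 1 (m + 1), ChebSpline.modulus (w j) δ ≤ Ω := fun j hj =>
    Finset.le_sup' (fun j => ChebSpline.modulus (w j) δ) hj
  have hΩ0 : 0 ≤ Ω := (ChebSpline.modulus_nonneg (w 1) δ).trans (hΩle 1 (by simp))
  have hΩM : Ω ≤ M := Finset.sup'_le _ _ fun j hj => ChebSpline.modulus_le hM (hb j hj) δ
  refine ⟨?_, fun hsm' => ChebSpline.chebBSplineOrd_eq hW hWne hk
    (fun j hj => (hsm' j hj).congr fun y hy => (hwW j hj hy).symm) hp hq hnode x⟩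
  -- For `k ≥ 2` both splines vanish at `x = 0`.
  by_cases hx0 : x = 0 ∧ 2 ≤ m + 1
  · obtain ⟨rfl, hk2⟩ := hx0
    have hC : 0 ≤ C₀ * Θ ^ N * (N * M + 1) / δ := by
      have : 0 < δ := sub_pos.2 hlt
      positivity
    rw [ChebSpline.chebBSpline_zero hWne hk2 hp hq hnode,
      ChebSpline.polyBSpline_eq_chebBSpline hk hp hq hnode,
      ChebSpline.chebBSpline_zero (fun _ _ => one_ne_zero) hk2 hp hq hnode, sub_self, abs_zero]
    exact ⟨mul_nonneg hC hΩ0, hC⟩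
  have hx' : x ≠ 0 ∨ m + 1 = 1 := by
    by_cases h : x = 0
    · exact Or.inr (by by_contra; exact hx0 ⟨h, by omega⟩)
    · exact Or.inl h
  have hi0 : 0 ≤ t i := by simpa using hnode.nonneg 0
  have hi1 : t (i + (m + 1)) ≤ 1 := by simpa using hnode.le_one (Fin.last (m + 1))
  -- The reference values are `a j = W j c`. With the midpoint, every `y` in the support has `|y -
  -- c| ≤ δ / 2 < δ`, as the strict inequality in the modulus demands.
  set c := (t i + t (i + (m + 1))) / 2 with hc
  have hcI : c ∈ Icc (0 : ℝ) 1 := ⟨by rw [hc]; linarith, by rw [hc]; linarith⟩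
  have hclose : ∀ j ∈ Finset.Icc 1 (m + 1), ∀ y ∈ Icc (t i) (t (i + (m + 1))),
      |w j y - w j c| ≤ Ω := fun j hj y hy =>
    (ChebSpline.abs_sub_le_modulus hM (hb j hj) ⟨hi0.trans hy.1, hy.2.trans hi1⟩ hcI (by
      have := hy.1
      have := hy.2
      rw [abs_lt, hc, hδ]
      constructor <;> linarith)).trans (hΩle j hj)
  -- The lower bound `1 / M` turns the additive error `Ω` into the multiplicative one `1 + M * Ω`.
  have hM1 : ∀ z, 1 / M ≤ z → Ω ≤ M * Ω * z := fun z hz => by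
    have h1 : 1 ≤ M * z := by rwa [div_le_iff₀' hM] at hz
    calc Ω = Ω * 1 := by ring
      _ ≤ Ω * (M * z) := mul_le_mul_of_nonneg_left h1 hΩ0
      _ = M * Ω * z := by ring
  refine ChebSpline.chebBSpline_estimates (a := fun j => W j c) hM hW hW0 hp hq hnode hΩ0 hΩM
    (fun j => hW0 j c) (fun j hj1 hjm y hy => ?_) (fun j hj1 hjm y hy => ?_) hx' hN hC₀ hΘ
  all_goals
    have hj : j ∈ Finset.Icc 1 (m + 1) := Finset.mem_Icc.2 ⟨hj1, hjm⟩
    have hyI : y ∈ Icc (0 : ℝ) 1 := ⟨hi0.trans hy.1, hy.2.trans hi1⟩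
    have h1 := abs_le.1 (hclose j hj y hy)
    have h2 := hM1 _ (hb j hj c hcI).1
    have h3 := hM1 _ (hb j hj y hyI).1
    rw [← hwW j hj hcI, ← hwW j hj hyI]
    linarith
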